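/- Manifolds are smooth ($C^\infty$), finite-dimensional and without boundary; the object manifolds $N$, $M$ are Hausdorff and second countable, while the arrow manifold of a Lie groupoid need not be Hausdorff unless stated. A Lie groupoid $\mathcal G\rightrightarrows M$ has smooth structure maps, with source $s$ and target $t$ submersions, unit map $u$, and product $gh$ defined when $s(g)=t(h)$. Let $\mathcal H\rightrightarrows N$ and $\mathcal G\rightrightarrows M$ be Lie groupoids and let $\Phi_0:\mathcal H\to\mathcal G$ be a Lie groupoid morphism covering $\phi_0:N\to M$. A deformation of $\Phi_0$ consists of an open interval $I\ni 0$ and smooth maps $\mathcal H\times I\to\mathcal G$, $(h,\varepsilon)\mapsto\Phi_\varepsilon(h)$, and $N\times I\to M$, $(x,\varepsilon)\mapsto\phi_\varepsilon(x)$, which give $(\Phi_0,\phi_0)$ at $\varepsilon=0$ and such that $\Phi_\varepsilon$ is a Lie groupoid morphism covering $\phi_\varepsilon$ for each $\varepsilon\in I$. Let $\Phi_\varepsilon$ (covering $\phi_\varepsilon$) and $\Phi'_\varepsilon$ (covering $\phi'_\varepsilon$) be two deformations of $\Phi_0$. They are called *equivalent* (gauge-equivalent) if there are an open interval $J\ni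 0$, contained in the parameter intervals of both, and a smooth map $N\times J\to\mathcal G$, $(x,\varepsilon)\mapsto\tau_\varepsilon(x)$, with $s\circ\tau_\varepsilon=\phi_\varepsilon$ for all $\varepsilon\in J$, $\tau_0=u\circ\phi_0$, and $$\Phi'_\varepsilon(h)=\tau_\varepsilon(t(h))\,\Phi_\varepsilon(h)\,\tau_\varepsilon(s(h))^{-1}\qquad\text{for all }\varepsilon\in J,\ h\in\mathcal H.$$ They are called *strongly equivalent* if there are an open interval $J\ni 0$, contained in the parameter intervals of both, and a smooth map $M\times J\to\mathcal G$, $(x,\varepsilon)\mapsto\sigma_\varepsilon(x)$, such that each $\sigma_\varepsilon$ is a bisection of $\mathcal G$ (that is, $s\circ\sigma_\varepsilon=\mathrm{id}_M$ and $t\circ\sigma_\varepsilon$ is a diffeomorphism of $M$), $\sigma_0=u$, and $$\Phi_\varepsilon(h)=\sigma_\varepsilon(\phi'_\varepsilon(t(h)))\,\Phi'_\varepsilon(h)\,\sigma_\varepsilon(\phi'_\varepsilon(s(h)))^{-1}\qquad\text{for all }\varepsilon\in J,\ h\in\mathcal H.$$ **Theorem.** Assume that $\phi_0$ is an injective immersion,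 $N$ is compact and $\mathcal G$ is Hausdorff. Then two deformations of $\Phi_0$ are equivalent if and only if they are strongly equivalent. -/

import Mathlib

open scoped Manifold ContDiff

noncomputable section LieGroupoidDefs

variable {EH EN EG EM : Type*}
  [NormedAddCommGroup EH] [NormedSpace ℝ EH] [FiniteDimensional ℝ EH]
  [NormedAddCommGroup EN] [NormedSpace ℝ EN] [FiniteDimensional ℝ EN]
  [NormedAddCommGroup EG] [NormedSpace ℝ EG] [FiniteDimensional ℝ EG]
  [NormedAddCommGroup EM] [NormedSpace ℝ EM] [FiniteDimensional ℝ EM]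
  {H N G M : Type*}
  [TopologicalSpace H] [ChartedSpace EH H] [IsManifold 𝓘(ℝ, EH) ∞ H]
  [TopologicalSpace N] [ChartedSpace EN N] [IsManifold 𝓘(ℝ, EN) ∞ N]
  [T2Space N] [SecondCountableTopology N]
  [TopologicalSpace G] [ChartedSpace EG G] [IsManifold 𝓘(ℝ, EG) ∞ G]
  [TopologicalSpace M] [ChartedSpace EM M] [IsManifold 𝓘(ℝ, EM) ∞ M]
  [T2Space M] [SecondCountableTopology M]

variable (EG EM G M) in
/-- A Lie groupoid with manifold of arrows `G` (modelled on `EG`, not required to be Hausdorff) and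
Hausdorff second countable manifold of objects `M` (modelled on `EM`).

The multiplication `mul g h = gh` is meaningful for `src g = tgt h` only; it is stored as a total
function whose values on other pairs are irrelevant and never constrained. As `src` and `tgt` are
submersions, the composable pairs form an embedded submanifold of `G × G`, and smoothness of the
multiplication on that submanifold is the same as smoothness on it as a subset of `G × G`
(local smooth extendability), which is what `ContMDiffOn` says. -/
structure LieGroupoid where
  /-- source -/
  src : G → M
  /-- target -/
  tgt : G → M
  /-- multiplication of composable arrows -/
  mul : G → G → G
  /-- inversion -/
  inv : G → G
  /-- identity arrows -/
  one : M → G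
  src_one : ∀ x, src (one x) = x
  tgt_one : ∀ x, tgt (one x) = x
  src_mul : ∀ g h, src g = tgt h → src (mul g h) = src h
  tgt_mul : ∀ g h, src g = tgt h → tgt (mul g h) = tgt g
  src_inv : ∀ g, src (inv g) = tgt g
  tgt_inv : ∀ g, tgt (inv g) = src g
  mul_assoc : ∀ g h k, src g = tgt h → src h = tgt k → mul (mul g h) k = mul g (mul h k)
  one_mul : ∀ g, mul (one (tgt g)) g = g
  mul_one : ∀ g, mul g (one (src g)) = g
  inv_mul : ∀ g, mul (inv g) g = one (src g)
  mul_inv : ∀ g, mul g (inv g) = one (tgt g)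
  isSubmersion_src : Manifold.IsSubmersion 𝓘(ℝ, EG) 𝓘(ℝ, EM) ∞ src
  isSubmersion_tgt : Manifold.IsSubmersion 𝓘(ℝ, EG) 𝓘(ℝ, EM) ∞ tgt
  contMDiff_one : ContMDiff 𝓘(ℝ, EM) 𝓘(ℝ, EG) ∞ one
  contMDiff_inv : ContMDiff 𝓘(ℝ, EG) 𝓘(ℝ, EG) ∞ inv
  contMDiffOn_mul : ContMDiffOn (𝓘(ℝ, EG).prod 𝓘(ℝ, EG)) 𝓘(ℝ, EG) ∞
    (fun p : G × G => mul p.1 p.2) {p : G × G | src p.1 = tgt p.2}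

namespace LieGroupoid

/-- `(Φ, φ)` is a morphism of Lie groupoids: a smooth functor with base map `φ`. -/
structure IsMorphism (ℋ : LieGroupoid EH EN H N) (𝒢 : LieGroupoid EG EM G M)
    (Φ : H → G) (φ : N → M) : Prop where
  contMDiff : ContMDiff 𝓘(ℝ, EH) 𝓘(ℝ, EG) ∞ Φ
  contMDiff_base : ContMDiff 𝓘(ℝ, EN) 𝓘(ℝ, EM) ∞ φ
  src_map : ∀ h, 𝒢.src (Φ h) = φ (ℋ.src h)
  tgt_map : ∀ h, 𝒢.tgt (Φ h) = φ (ℋ.tgt h)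
  map_one : ∀ x, Φ (ℋ.one x) = 𝒢.one (φ x)
  map_mul : ∀ h k, ℋ.src h = ℋ.tgt k → Φ (ℋ.mul h k) = 𝒢.mul (Φ h) (Φ k)

/-- An open interval (possibly unbounded) containing `0`. -/
def IsOpenIntervalZero (J : Set ℝ) : Prop :=
  IsOpen J ∧ J.OrdConnected ∧ (0 : ℝ) ∈ J

/-- A deformation of `(Φ₀, φ₀)`: a smooth family `(Φ_ε, φ_ε)` of morphisms, parametrized by an open
interval containing `0`, whose member at `0` is `(Φ₀, φ₀)`. Values for `ε` outside the interval are
irrelevant. -/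
structure Deformation (ℋ : LieGroupoid EH EN H N) (𝒢 : LieGroupoid EG EM G M)
    (Φ₀ : H → G) (φ₀ : N → M) where
  /-- the interval of parameters -/
  interval : Set ℝ
  /-- the maps `Φ_ε` on arrows -/
  map : ℝ → H → G
  /-- the maps `φ_ε` on objects -/
  base : ℝ → N → M
  isOpenIntervalZero : IsOpenIntervalZero interval
  contMDiffOn_map : ContMDiffOn (𝓘(ℝ, EH).prod 𝓘(ℝ, ℝ)) 𝓘(ℝ, EG) ∞
    (fun p : H × ℝ => map p.2 p.1) (Set.univ ×ˢ interval)
  contMDiffOn_base : ContMDiffOn (𝓘(ℝ, EN).prod 𝓘(ℝ, ℝ)) 𝓘(ℝ, EM) ∞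
    (fun p : N × ℝ => base p.2 p.1) (Set.univ ×ˢ interval)
  isMorphism : ∀ ε ∈ interval, IsMorphism ℋ 𝒢 (map ε) (base ε)
  map_zero : map 0 = Φ₀
  base_zero : base 0 = φ₀

/-- A (global) bisection: a smooth section `σ` of the source map such that `tgt ∘ σ` is a
diffeomorphism of `M`. -/
structure IsBisection (𝒢 : LieGroupoid EG EM G M) (σ : M → G) : Prop where
  contMDiff : ContMDiff 𝓘(ℝ, EM) 𝓘(ℝ, EG) ∞ σ
  src_apply : ∀ x, 𝒢.src (σ x) = x
  exists_diffeomorph : ∃ f : M ≃ₘ⟮𝓘(ℝ, EM), 𝓘(ℝ, EM)⟯ M, ∀ x, f x = 𝒢.tgt (σ x)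

namespace Deformation

variable {ℋ : LieGroupoid EH EN H N} {𝒢 : LieGroupoid EG EM G M} {Φ₀ : H → G} {φ₀ : N → M}

/-- Gauge equivalence of the deformations `Φ` and `Φ'`: there is a smooth family of gauge maps
`τ_ε : N → G` covering `φ_ε`, with `τ_0 = one ∘ φ₀`, such that
`Φ'_ε(h) = τ_ε(t(h)) Φ_ε(h) τ_ε(s(h))⁻¹` for all `h` and all `ε` in an open interval around `0`. -/
def Equivalent (D D' : Deformation ℋ 𝒢 Φ₀ φ₀) : Prop :=
  ∃ J : Set ℝ, IsOpenIntervalZero J ∧ J ⊆ D.interval ∧ J ⊆ D'.interval ∧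
    ∃ τ : ℝ → N → G,
      ContMDiffOn (𝓘(ℝ, EN).prod 𝓘(ℝ, ℝ)) 𝓘(ℝ, EG) ∞
        (fun p : N × ℝ => τ p.2 p.1) (Set.univ ×ˢ J) ∧
      (∀ ε ∈ J, ∀ x, 𝒢.src (τ ε x) = D.base ε x) ∧
      (∀ x, τ 0 x = 𝒢.one (φ₀ x)) ∧
      ∀ ε ∈ J, ∀ h, D'.map ε h =
        𝒢.mul (𝒢.mul (τ ε (ℋ.tgt h)) (D.map ε h)) (𝒢.inv (τ ε (ℋ.src h)))

/-- Strong equivalence of the deformations `Φ` and `Φ'`: there is a smooth family of bisections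
`σ_ε` of the groupoid, with `σ_0` the identity bisection, such that
`Φ_ε(h) = σ_ε(φ'_ε(t(h))) Φ'_ε(h) σ_ε(φ'_ε(s(h)))⁻¹` for all `h` and all `ε` in an open interval
around `0`. -/
def StronglyEquivalent (D D' : Deformation ℋ 𝒢 Φ₀ φ₀) : Prop :=
  ∃ J : Set ℝ, IsOpenIntervalZero J ∧ J ⊆ D.interval ∧ J ⊆ D'.interval ∧
    ∃ σ : ℝ → M → G,
      ContMDiffOn (𝓘(ℝ, EM).prod 𝓘(ℝ, ℝ)) 𝓘(ℝ, EG) ∞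
        (fun p : M × ℝ => σ p.2 p.1) (Set.univ ×ˢ J) ∧
      (∀ ε ∈ J, 𝒢.IsBisection (σ ε)) ∧
      σ 0 = 𝒢.one ∧
      ∀ ε ∈ J, ∀ h, D.map ε h =
        𝒢.mul (𝒢.mul (σ ε (D'.base ε (ℋ.tgt h))) (D'.map ε h))
          (𝒢.inv (σ ε (D'.base ε (ℋ.src h))))

end Deformation

end LieGroupoid

end LieGroupoidDefs

/-! ### Uniformity over compact sets, and inversion of small perturbations of the identity. -/

section SmoothFamilies

open Set Topology Filter

universe u

/-! Strong equivalence gives gauge equivalence by pure algebra: put `τ_ε(x) = σ_ε(φ'_ε(x))⁻¹`.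
Conversely, given `τ`, the arrows `θ_ε(x) = τ_ε(x)⁻¹` have source `φ'_ε(x)`, and a family of
bisections is needed with `σ_ε(φ'_ε(x)) = θ_ε(x)`: gauge data along the moving image of `N` must be
extended to all of `M`.

Locally (`exists_mem_nhds_hasBisectionExtension`), trivialize the source map near a unit so that
units form the zero section. The fibre coordinate of `θ`, transported to `M` by a smooth left
inverse of the moving base map (`exists_leftInverse_family`), can then be multiplied by a bump
function. This gives sections of the source map equal to units off a compact set; composed with the
target they are diffeomorphisms for small `ε` (`exists_diffeomorph_of_eq_self_off_compact`).
Injectivity of `φ₀` and compactness of `N` keep remote parts of `N` out of the support of the bump.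

Globally, local extensions are multiplied, not added (`HasBisectionExtension.union`): after dividing
`θ` by one bisection family, the next extends the quotient and leaves alone the points where the
quotient is already a unit. Compactness of `N` leaves finitely many factors. -/

theorem IsCompact.exists_pos_forall_abs_lt {X : Type*} [TopologicalSpace X] {K : Set X}
    (hK : IsCompact K) {P : X → ℝ → Prop}
    (hP : ∀ x ∈ K, ∀ᶠ p in 𝓝 ((x, 0) : X × ℝ), P p.1 p.2) :
    ∃ δ > 0, ∀ ε ∈ Ioo (-δ) δ, ∀ x ∈ K, P x ε := by
  have h : ∀ᶠ ε in 𝓝 (0 : ℝ), ∀ x ∈ K, P x ε := by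
    refine hK.eventually_forall_of_forall_eventually (P := fun ε x => P x ε) fun x hx => ?_
    have h2 : Tendsto (fun z : ℝ × X => (z.2, z.1)) (𝓝 ((0, x) : ℝ × X)) (𝓝 ((x, 0) : X × ℝ)) :=
      (continuous_swap.tendsto ((0, x) : ℝ × X))
    exact h2.eventually (hP x hx)
  obtain ⟨δ, hδ, h⟩ := Metric.eventually_nhds_iff_ball.1 h
  refine ⟨δ, hδ, fun ε hε => h ε ?_⟩
  rw [Real.ball_eq_Ioo]
  simpa using hε

/-- A compactly supported smooth perturbation of the identity, depending smoothly on a parameter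
and vanishing at parameter `0`, is invertible for small parameters, with smooth inverse. -/
theorem exists_contDiffOn_inverse_add {E : Type*} [NormedAddCommGroup E] [NormedSpace ℝ E]
    [FiniteDimensional ℝ E] {g : ℝ → E → E} {δ : ℝ} (hδ : 0 < δ)
    (hg : ContDiffOn ℝ ∞ (fun p : E × ℝ => g p.2 p.1) (univ ×ˢ Ioo (-δ) δ))
    (h0 : ∀ z, g 0 z = 0) {K : Set E} (hK : IsCompact K)
    (hgK : ∀ ε ∈ Ioo (-δ) δ, ∀ z ∉ K, g ε z = 0) :
    ∃ δ' > 0, δ' ≤ δ ∧ ∃ l : ℝ → E → E,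
      ContDiffOn ℝ ∞ (fun p : E × ℝ => l p.2 p.1) (univ ×ˢ Ioo (-δ') δ') ∧
      ∀ ε ∈ Ioo (-δ') δ', ∀ z y, z + g ε z = y ↔ z = l ε y := by
  have : CompleteSpace E := FiniteDimensional.complete ℝ E
  set G : E × ℝ → E := fun p => g p.2 p.1 with hG
  have hO : IsOpen ((univ : Set E) ×ˢ Ioo (-δ) δ) := isOpen_univ.prod isOpen_Ioo
  have hGat : ∀ z, ∀ ε ∈ Ioo (-δ) δ, ContDiffAt ℝ ∞ G (z, ε) := fun z ε hε =>
    hg.contDiffAt (hO.mem_nhds ⟨mem_univ _, hε⟩)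
  set A : E × ℝ → E →L[ℝ] E := fun p => (fderiv ℝ G p).comp (ContinuousLinearMap.inl ℝ E ℝ) with hA
  have hder : ∀ z, ∀ ε ∈ Ioo (-δ) δ, HasFDerivAt (g ε) (A (z, ε)) z := fun z ε hε =>
    ((hGat z ε hε).differentiableAt (by simp)).hasFDerivAt.comp (f := fun z => (z, ε)) z
      (hasFDerivAt_prodMk_left z ε)
  have h0mem : (0 : ℝ) ∈ Ioo (-δ) δ := ⟨by linarith, hδ⟩
  have hA0 : ∀ z, A (z, 0) = 0 := fun z => by
    have h1 := hder z 0 h0mem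
    have h2 : g 0 = fun _ => (0 : E) := funext h0
    rw [h2] at h1
    exact h1.unique (hasFDerivAt_const _ _)
  have hAc : ∀ z, ContinuousAt A (z, 0) := fun z => by
    have h1 : ContinuousAt (fderiv ℝ G) (z, 0) :=
      ((hGat z 0 h0mem).fderiv_right (m := 0) (by simp)).continuousAt
    exact h1.clm_comp continuousAt_const
  -- The partial derivative `A` vanishes at parameter `0`, so it is below `1 / 2` on `K` for small
  -- parameters; off `K` it is zero. Any bound below `1` would do: it makes `z ↦ y - g ε z` a
  -- contraction, whose fixed points are the solutions of `z + g ε z = y`.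
  obtain ⟨δ₁, hδ₁, hsmall⟩ := hK.exists_pos_forall_abs_lt (P := fun z ε => ‖A (z, ε)‖ < 1 / 2)
    (fun z _ => (hAc z).norm.eventually_lt continuousAt_const (by simp [hA0]))
  have hle : Ioo (-(min δ₁ δ)) (min δ₁ δ) ⊆ Ioo (-δ) δ := Ioo_subset_Ioo
    (neg_le_neg (min_le_right _ _)) (min_le_right _ _)
  have hle₁ : Ioo (-(min δ₁ δ)) (min δ₁ δ) ⊆ Ioo (-δ₁) δ₁ := Ioo_subset_Ioo
    (neg_le_neg (min_le_left _ _)) (min_le_left _ _)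
  have hnorm : ∀ ε ∈ Ioo (-(min δ₁ δ)) (min δ₁ δ), ∀ z, ‖A (z, ε)‖ ≤ 1 / 2 := by
    intro ε hε z
    by_cases hz : z ∈ K
    · exact (hsmall ε (hle₁ hε) z hz).le
    · have h1 : g ε =ᶠ[𝓝 z] fun _ => (0 : E) := by
        filter_upwards [hK.isClosed.isOpen_compl.mem_nhds hz] with w hw
        exact hgK ε (hle hε) w hw
      have h2 : A (z, ε) = 0 :=
        (hder z ε (hle hε)).unique ((hasFDerivAt_const (0 : E) z).congr_of_eventuallyEq h1)
      rw [h2]; simp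
  have hlip : ∀ ε ∈ Ioo (-(min δ₁ δ)) (min δ₁ δ), LipschitzWith (1 / 2) (g ε) := by
    intro ε hε
    refine lipschitzWith_of_nnnorm_fderiv_le (𝕜 := ℝ)
      (fun z => (hder z ε (hle hε)).differentiableAt) fun z => ?_
    rw [(hder z ε (hle hε)).fderiv, ← NNReal.coe_le_coe]
    simpa using hnorm ε hε z
  have hex : ∀ ε y, ∃ w, ε ∈ Ioo (-(min δ₁ δ)) (min δ₁ δ) → ∀ z, z + g ε z = y ↔ z = w := by
    intro ε y
    by_cases hε : ε ∈ Ioo (-(min δ₁ δ)) (min δ₁ δ)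
    · have hc : ContractingWith (1 / 2) (fun z => y - g ε z) := by
        refine ⟨by rw [← NNReal.coe_lt_coe]; norm_num, ?_⟩
        refine LipschitzWith.of_dist_le_mul fun z w => ?_
        rw [dist_sub_left]
        exact (hlip ε hε).dist_le_mul z w
      refine ⟨ContractingWith.fixedPoint _ hc, fun _ z => ?_⟩
      rw [← eq_sub_iff_add_eq]
      constructor
      · intro h
        exact hc.fixedPoint_unique h.symm
      · rintro h
        have := hc.fixedPoint_isFixedPt
        rw [← h] at this
        exact this.symm
    · exact ⟨0, fun h => (hε h).elim⟩
  choose l hl using hex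
  refine ⟨min δ₁ δ, lt_min hδ₁ hδ, min_le_right _ _, l, ?_, fun ε hε z y => hl ε y hε z⟩
  rintro ⟨y₀, ε₀⟩ ⟨-, hε₀⟩
  refine ContDiffAt.contDiffWithinAt ?_
  set z₀ := l ε₀ y₀ with hz₀
  have hz₀y : z₀ + g ε₀ z₀ = y₀ := (hl ε₀ y₀ hε₀ z₀).2 rfl
  -- Keeping the parameter as a second coordinate lets the inverse function theorem give smoothness
  -- of `l` jointly in point and parameter. The derivative is injective because `u + A u = 0` forces
  -- `‖u‖ ≤ ‖u‖ / 2`.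
  set Fm : E × ℝ → E × ℝ := fun p => (p.1 + G p, p.2) with hFm
  have hFsm : ContDiffAt ℝ ∞ Fm (z₀, ε₀) :=
    (contDiffAt_fst.add (hGat z₀ ε₀ (hle hε₀))).prodMk contDiffAt_snd
  have hFder := (hFsm.differentiableAt (by simp)).hasFDerivAt
  set T := fderiv ℝ Fm (z₀, ε₀) with hT
  have hTeq : T = (ContinuousLinearMap.fst ℝ E ℝ + fderiv ℝ G (z₀, ε₀)).prod
      (ContinuousLinearMap.snd ℝ E ℝ) := by
    refine hFder.unique ?_
    exact ((hasFDerivAt_fst).add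
      ((hGat z₀ ε₀ (hle hε₀)).differentiableAt (by simp)).hasFDerivAt).prodMk hasFDerivAt_snd
  have hTinj : Function.Injective T := by
    rw [injective_iff_map_eq_zero]
    rintro ⟨u, s⟩ hus
    rw [hTeq] at hus
    simp only [ContinuousLinearMap.prod_apply, ContinuousLinearMap.coe_snd', Prod.mk_eq_zero,
      add_apply, ContinuousLinearMap.coe_fst'] at hus
    obtain ⟨h1, rfl⟩ := hus
    have h2 : u + A (z₀, ε₀) u = 0 := by simpa [hA] using h1
    have h3 : ‖u‖ ≤ 1 / 2 * ‖u‖ := by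
      calc ‖u‖ = ‖A (z₀, ε₀) u‖ := by
            rw [← norm_neg (A (z₀, ε₀) u), ← eq_neg_of_add_eq_zero_left h2]
        _ ≤ ‖A (z₀, ε₀)‖ * ‖u‖ := ContinuousLinearMap.le_opNorm _ _
        _ ≤ 1 / 2 * ‖u‖ := by gcongr; exact hnorm ε₀ hε₀ z₀
    have h4 : u = 0 := by
      rw [← norm_le_zero_iff]; linarith [norm_nonneg u]
    simp [h4]
  set T' : (E × ℝ) ≃L[ℝ] (E × ℝ) :=
    (LinearEquiv.ofInjectiveEndo T.toLinearMap hTinj).toContinuousLinearEquiv with hT'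
  have hT'T : (T' : (E × ℝ) →L[ℝ] (E × ℝ)) = T := by ext <;> simp [hT']
  rw [← hT'T] at hFder
  have hinv := hFsm.to_localInverse hFder (by simp)
  have hright := (hFsm.hasStrictFDerivAt' hFder (by simp)).eventually_right_inverse
  have hFz : Fm (z₀, ε₀) = (y₀, ε₀) := by simp [hFm, hG, hz₀y]
  rw [hFz] at hinv hright
  -- Uniqueness of the solution identifies the globally chosen `l` with the local inverse.
  refine hinv.fst.congr_of_eventuallyEq ?_
  have hev : ∀ᶠ p in 𝓝 ((y₀, ε₀) : E × ℝ), p.2 ∈ Ioo (-(min δ₁ δ)) (min δ₁ δ) :=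
    continuous_snd.continuousAt.eventually (isOpen_Ioo.mem_nhds hε₀)
  filter_upwards [hright, hev] with p hp hp2
  change Fm (hFsm.localInverse hFder (by simp) p) = p at hp
  set w := hFsm.localInverse hFder (by simp) p
  have hw1 : w.1 + g w.2 w.1 = p.1 := congrArg Prod.fst hp
  have hw2 : w.2 = p.2 := by simpa [hFm] using congrArg Prod.snd hp
  rw [hw2] at hw1
  exact ((hl p.2 p.1 hp2 w.1).1 hw1).symm

/-! ### Smooth families of maps and of diffeomorphisms. -/

section Families

variable {E E' : Type*} [NormedAddCommGroup E] [NormedSpace ℝ E]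
  [NormedAddCommGroup E'] [NormedSpace ℝ E']
  {X Y : Type*} [TopologicalSpace X] [ChartedSpace E X] [TopologicalSpace Y] [ChartedSpace E' Y]

theorem contMDiffAt_prod_self_iff {f : E × ℝ → E'} {p : E × ℝ} :
    ContMDiffAt (𝓘(ℝ, E).prod 𝓘(ℝ, ℝ)) 𝓘(ℝ, E') ∞ f p ↔ ContDiffAt ℝ ∞ f p := by
  rw [← contMDiffAt_iff_contDiffAt, modelWithCornersSelf_prod, ← chartedSpaceSelf_prod]

theorem univ_prod_mem_nhds {J : Set ℝ} (hJ : IsOpen J) {x : X} {ε : ℝ} (hε : ε ∈ J) :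
    (univ : Set X) ×ˢ J ∈ 𝓝 (x, ε) :=
  (isOpen_univ.prod hJ).mem_nhds ⟨mem_univ _, hε⟩

theorem ContMDiffOn.contMDiffAt_family {u : ℝ → X → Y} {J : Set ℝ} (hJ : IsOpen J)
    (hu : ContMDiffOn (𝓘(ℝ, E).prod 𝓘(ℝ, ℝ)) 𝓘(ℝ, E') ∞ (fun p : X × ℝ => u p.2 p.1) (univ ×ˢ J))
    (x : X) {ε : ℝ} (hε : ε ∈ J) :
    ContMDiffAt (𝓘(ℝ, E).prod 𝓘(ℝ, ℝ)) 𝓘(ℝ, E') ∞ (fun p : X × ℝ => u p.2 p.1) (x, ε) :=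
  hu.contMDiffAt (univ_prod_mem_nhds hJ hε)

theorem ContMDiffOn.contMDiff_family_apply {u : ℝ → X → Y} {J : Set ℝ} (hJ : IsOpen J)
    (hu : ContMDiffOn (𝓘(ℝ, E).prod 𝓘(ℝ, ℝ)) 𝓘(ℝ, E') ∞ (fun p : X × ℝ => u p.2 p.1) (univ ×ˢ J))
    {ε : ℝ} (hε : ε ∈ J) : ContMDiff 𝓘(ℝ, E) 𝓘(ℝ, E') ∞ (u ε) := fun x =>
  (hu.contMDiffAt_family hJ x hε).comp (f := fun x => (x, ε)) x
    (contMDiffAt_id.prodMk contMDiffAt_const)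

theorem isOpenIntervalZero_Ioo {δ : ℝ} (hδ : 0 < δ) :
    LieGroupoid.IsOpenIntervalZero (Ioo (-δ) δ) :=
  ⟨isOpen_Ioo, ordConnected_Ioo, by constructor <;> linarith⟩

theorem LieGroupoid.IsOpenIntervalZero.exists_Ioo_subset {J : Set ℝ}
    (hJ : LieGroupoid.IsOpenIntervalZero J) : ∃ δ > 0, Ioo (-δ) δ ⊆ J := by
  obtain ⟨δ, hδ, h⟩ := Metric.isOpen_iff.1 hJ.1 0 hJ.2.2
  refine ⟨δ, hδ, ?_⟩
  rw [Real.ball_eq_Ioo] at h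
  simpa using h

theorem Ioo_neg_subset_Ioo_neg {a b : ℝ} (h : a ≤ b) : Ioo (-a) a ⊆ Ioo (-b) b :=
  Ioo_subset_Ioo (neg_le_neg h) h

/-- A smooth family of self-maps of a manifold which is the identity at parameter `0` and away from
a compact subset of a chart domain consists of diffeomorphisms for small parameters. -/
theorem exists_diffeomorph_of_eq_self_off_compact [FiniteDimensional ℝ E]
    [IsManifold 𝓘(ℝ, E) ∞ X] [T2Space X]
    {e : OpenPartialHomeomorph X E} (he : e ∈ IsManifold.maximalAtlas 𝓘(ℝ, E) ∞ X)
    {K : Set X} (hK : IsCompact K) (hKe : K ⊆ e.source) {k : ℝ → X → X} {δ : ℝ} (hδ : 0 < δ)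
    (hk : ContMDiffOn (𝓘(ℝ, E).prod 𝓘(ℝ, ℝ)) 𝓘(ℝ, E) ∞ (fun p : X × ℝ => k p.2 p.1)
      (univ ×ˢ Ioo (-δ) δ))
    (hk0 : ∀ x, k 0 x = x) (hkK : ∀ ε ∈ Ioo (-δ) δ, ∀ x ∉ K, k ε x = x) :
    ∃ δ' > 0, δ' ≤ δ ∧ ∀ ε ∈ Ioo (-δ') δ',
      ∃ f : X ≃ₘ⟮𝓘(ℝ, E), 𝓘(ℝ, E)⟯ X, ∀ x, f x = k ε x := by
  classical
  have h0mem : (0 : ℝ) ∈ Ioo (-δ) δ := ⟨by linarith, hδ⟩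
  have hkat := fun x ε hε => hk.contMDiffAt_family isOpen_Ioo x (ε := ε) hε
  have hesm : ∀ x ∈ e.source, ContMDiffAt 𝓘(ℝ, E) 𝓘(ℝ, E) ∞ e x := fun x hx =>
    (contMDiffOn_of_mem_maximalAtlas he).contMDiffAt (e.open_source.mem_nhds hx)
  have hesymm : ∀ z ∈ e.target, ContMDiffAt 𝓘(ℝ, E) 𝓘(ℝ, E) ∞ e.symm z := fun z hz =>
    (contMDiffOn_symm_of_mem_maximalAtlas he).contMDiffAt (e.open_target.mem_nhds hz)
  obtain ⟨δ₁, hδ₁, hsrc⟩ := hK.exists_pos_forall_abs_lt (P := fun x ε => k ε x ∈ e.source)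
    (fun x hx => (hkat x 0 h0mem).continuousAt.eventually
      (e.open_source.mem_nhds (by simpa [hk0] using hKe hx)))
  set δ₂ := min δ₁ δ with hδ₂
  have hδ₂pos : 0 < δ₂ := lt_min hδ₁ hδ
  have hle := Ioo_neg_subset_Ioo_neg (min_le_right δ₁ δ)
  have hle₁ := Ioo_neg_subset_Ioo_neg (min_le_left δ₁ δ)
  have hmaps : ∀ ε ∈ Ioo (-δ₂) δ₂, ∀ x ∈ e.source, k ε x ∈ e.source := by
    intro ε hε x hx
    by_cases hxK : x ∈ K
    · exact hsrc ε (hle₁ hε) x hxK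
    · rwa [hkK ε (hle hε) x hxK]
  have hK'c : IsCompact (e '' K) := hK.image_of_continuousOn (e.continuousOn.mono hKe)
  -- The displacement of `k ε` read in the chart. It vanishes off the compact set `e '' K`, so its
  -- extension by zero is smooth on all of `E`.
  set g : ℝ → E → E := fun ε z => if z ∈ e.target then e (k ε (e.symm z)) - z else 0 with hg
  have hgK : ∀ ε ∈ Ioo (-δ₂) δ₂, ∀ z ∉ e '' K, g ε z = 0 := by
    intro ε hε z hz
    by_cases hzt : z ∈ e.target
    · have : e.symm z ∉ K := fun h => hz ⟨_, h, e.right_inv hzt⟩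
      simp [hg, hzt, hkK ε (hle hε) _ this]
    · simp [hg, hzt]
  have hgsm : ContDiffOn ℝ ∞ (fun p : E × ℝ => g p.2 p.1) (univ ×ˢ Ioo (-δ₂) δ₂) := by
    rintro ⟨z, ε⟩ ⟨-, hε⟩
    refine ContDiffAt.contDiffWithinAt ?_
    by_cases hz : z ∈ e '' K
    · have hzt : z ∈ e.target := by
        obtain ⟨x, hx, rfl⟩ := hz
        exact e.map_source (hKe hx)
      have h1 : ContMDiffAt (𝓘(ℝ, E).prod 𝓘(ℝ, ℝ)) 𝓘(ℝ, E) ∞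
          (fun p : E × ℝ => e (k p.2 (e.symm p.1))) (z, ε) := by
        refine ContMDiffAt.comp (g := e) (z, ε)
          (hesm _ (hmaps ε hε _ (e.map_target hzt))) ?_
        refine ContMDiffAt.comp (g := fun p : X × ℝ => k p.2 p.1)
          (f := fun p : E × ℝ => (e.symm p.1, p.2)) (z, ε) (hkat _ ε (hle hε)) ?_
        exact (ContMDiffAt.comp (g := e.symm) (z, ε) (hesymm z hzt) contMDiffAt_fst).prodMk
          contMDiffAt_snd
      refine ((contMDiffAt_prod_self_iff.1 h1).sub contDiffAt_fst).congr_of_eventuallyEq ?_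
      filter_upwards [continuous_fst.continuousAt.eventually (e.open_target.mem_nhds hzt)]
        with p hp
      simp only [hg]
      rw [if_pos (show p.1 ∈ e.target from hp)]
    · refine (contDiffAt_const (c := (0 : E))).congr_of_eventuallyEq ?_
      filter_upwards [(hK'c.isClosed.isOpen_compl.prod isOpen_Ioo).mem_nhds
        (show (z, ε) ∈ (e '' K)ᶜ ×ˢ Ioo (-δ₂) δ₂ from ⟨hz, hε⟩)] with p hp
      exact hgK _ hp.2 _ hp.1
  obtain ⟨δ₃, hδ₃, hδ₃le, l, hl, hlinv⟩ := exists_contDiffOn_inverse_add hδ₂pos hgsm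
    (fun z => by by_cases hz : z ∈ e.target <;> simp [hg, hz, hk0]) hK'c hgK
  refine ⟨δ₃, hδ₃, hδ₃le.trans (min_le_right _ _), fun ε hε => ?_⟩
  have hε₂ := Ioo_neg_subset_Ioo_neg hδ₃le hε
  have hlK : ∀ z ∉ e '' K, l ε z = z := fun z hz =>
    ((hlinv ε hε z z).1 (by rw [hgK ε hε₂ z hz, add_zero])).symm
  -- If `l ε z` left the target, the displacement there would be zero, so `l ε z = z`, which lies in
  -- the target.
  have hlt : ∀ z ∈ e.target, l ε z ∈ e.target := by
    intro z hz
    by_contra hlz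
    have h1 := (hlinv ε hε (l ε z) z).2 rfl
    rw [show g ε (l ε z) = 0 by simp only [hg]; rw [if_neg hlz], add_zero] at h1
    exact hlz (by rw [h1]; exact hz)
  have hlsm : ContDiff ℝ ∞ (l ε) := by
    refine contDiff_iff_contDiffAt.2 fun z => ?_
    exact (hl.contDiffAt (univ_prod_mem_nhds isOpen_Ioo hε)).comp (f := fun z => (z, ε)) z
      (contDiffAt_id.prodMk contDiffAt_const)
  set m : X → X := fun x => if x ∈ e.source then e.symm (l ε (e x)) else x with hm
  have hkm : ∀ x, k ε (m x) = x := by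
    intro x
    by_cases hx : x ∈ e.source
    · have hz := hlt _ (e.map_source hx)
      have h1 := (hlinv ε hε (l ε (e x)) (e x)).2 rfl
      simp only [hg] at h1
      rw [if_pos hz, add_sub_cancel] at h1
      simp only [hm]
      rw [if_pos hx]
      exact e.injOn (hmaps ε hε₂ _ (e.map_target hz)) hx h1
    · simp only [hm]
      rw [if_neg hx, hkK ε (hle hε₂) x (fun h => hx (hKe h))]
  have hmk : ∀ x, m (k ε x) = x := by
    intro x
    by_cases hx : x ∈ e.source
    · have hkx := hmaps ε hε₂ x hx
      have h1 : e x = l ε (e (k ε x)) := (hlinv ε hε _ _).1 (by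
        simp only [hg]
        rw [if_pos (e.map_source hx), e.left_inv hx, add_sub_cancel])
      simp only [hm]
      rw [if_pos hkx, ← h1, e.left_inv hx]
    · rw [hkK ε (hle hε₂) x (fun h => hx (hKe h))]
      simp only [hm]
      rw [if_neg hx]
  have hmsm : ContMDiff 𝓘(ℝ, E) 𝓘(ℝ, E) ∞ m := by
    intro x
    by_cases hx : x ∈ K
    · have hxs := hKe hx
      have h1 : ContMDiffAt 𝓘(ℝ, E) 𝓘(ℝ, E) ∞ (fun x => e.symm (l ε (e x))) x :=
        ContMDiffAt.comp (g := e.symm) x (hesymm _ (hlt _ (e.map_source hxs)))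
          (ContMDiffAt.comp (g := l ε) x hlsm.contDiffAt.contMDiffAt (hesm x hxs))
      refine h1.congr_of_eventuallyEq ?_
      filter_upwards [e.open_source.mem_nhds hxs] with y hy
      simp only [hm]
      rw [if_pos hy]
    · refine (contMDiffAt_id (x := x)).congr_of_eventuallyEq ?_
      filter_upwards [hK.isClosed.isOpen_compl.mem_nhds hx] with y hy
      simp only [hm, id]
      split_ifs with hys
      · rw [hlK, e.left_inv hys]
        rintro ⟨w, hw, hwy⟩
        exact hy (e.injOn (hKe hw) hys hwy ▸ hw)
      · rfl
  exact ⟨⟨⟨k ε, m, hmk, hkm⟩, hk.contMDiff_family_apply isOpen_Ioo (hle hε₂), hmsm⟩, fun _ => rfl⟩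

end Families

/-! ### Normal forms of immersions and submersions, and of the source map near a unit. -/

section NormalForms

variable {E E' : Type*} [NormedAddCommGroup E] [NormedSpace ℝ E]
  [NormedAddCommGroup E'] [NormedSpace ℝ E']
  {X Y : Type*} [TopologicalSpace X] [ChartedSpace E X]
  [TopologicalSpace Y] [ChartedSpace E' Y]

/-- Near a point where `f` is an immersion, a chart of the source factors smoothly through `f`. -/
theorem Manifold.IsImmersionAt.exists_chart_eq_comp {f : X → Y} {x : X}
    (hf : Manifold.IsImmersionAt 𝓘(ℝ, E) 𝓘(ℝ, E') ∞ f x) :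
    ∃ a ∈ IsManifold.maximalAtlas 𝓘(ℝ, E) ∞ X, x ∈ a.source ∧
      ∃ U : Set Y, IsOpen U ∧ ∃ q : Y → E, ContMDiffOn 𝓘(ℝ, E') 𝓘(ℝ, E) ∞ q U ∧
        ∀ y ∈ a.source, f y ∈ U ∧ q (f y) = a y := by
  refine ⟨hf.domChart, hf.domChart_mem_maximalAtlas, hf.mem_domChart_source,
    hf.codChart.source, hf.codChart.open_source,
    fun y => (hf.equiv.symm (hf.codChart y)).1, ?_, fun y hy => ⟨?_, ?_⟩⟩
  · have h1 : ContMDiffOn 𝓘(ℝ, E') 𝓘(ℝ, E') ∞ hf.codChart hf.codChart.source :=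
      contMDiffOn_of_mem_maximalAtlas hf.codChart_mem_maximalAtlas
    have h2 : ContDiff ℝ ∞ (fun z => (hf.equiv.symm z).1) := hf.equiv.symm.contDiff.fst
    exact h2.contMDiff.comp_contMDiffOn h1
  · exact hf.source_subset_preimage_source hy
  · have h := hf.writtenInCharts 
      (show hf.domChart y ∈ (hf.domChart.extend 𝓘(ℝ, E)).target by
        simpa using hf.domChart.map_source hy)
    simp only [OpenPartialHomeomorph.extend, Function.comp_apply] at h
    simp only [mfld_simps] at h
    rw [hf.domChart.left_inv hy] at h
    beta_reduce
    rw [h]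
    simp

/-- Local trivialization of a submersion near a point. -/
theorem Manifold.IsSubmersionAt.exists_trivialization {E : Type u}
    [NormedAddCommGroup E] [NormedSpace ℝ E]
    {X : Type*} [TopologicalSpace X] [ChartedSpace E X]
    {f : X → Y} {x : X}
    (hf : Manifold.IsSubmersionAt 𝓘(ℝ, E) 𝓘(ℝ, E') ∞ f x) :
    ∃ (F : Type u) (_ : NormedAddCommGroup F) (_ : NormedSpace ℝ F) (W : Set X) (Q : Set (Y × F))
      (φ : X → F) (ψ : Y × F → X), IsOpen W ∧ IsOpen Q ∧ x ∈ W ∧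
      ContMDiffOn 𝓘(ℝ, E) 𝓘(ℝ, F) ∞ φ W ∧
      ContMDiffOn (𝓘(ℝ, E').prod 𝓘(ℝ, F)) 𝓘(ℝ, E) ∞ ψ Q ∧
      (∀ g ∈ W, (f g, φ g) ∈ Q ∧ ψ (f g, φ g) = g) ∧ ∀ p ∈ Q, f (ψ p) = p.1 := by
  have hw : ∀ z ∈ hf.domChart.target,
      hf.codChart (f (hf.domChart.symm z)) = (hf.equiv z).1 := by
    intro z hz
    have h := hf.writtenInCharts 
      (show z ∈ (hf.domChart.extend 𝓘(ℝ, E)).target by simpa using hz)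
    simp only [OpenPartialHomeomorph.extend, Function.comp_apply] at h
    simpa only [mfld_simps] using h
  have hw' : ∀ g ∈ hf.domChart.source, hf.codChart (f g) = (hf.equiv (hf.domChart g)).1 := by
    intro g hg
    rw [← hw _ (hf.domChart.map_source hg), hf.domChart.left_inv hg]
  have h1 : ContMDiffOn 𝓘(ℝ, E) 𝓘(ℝ, E) ∞ hf.domChart hf.domChart.source :=
    contMDiffOn_of_mem_maximalAtlas hf.domChart_mem_maximalAtlas
  have h1' : ContMDiffOn 𝓘(ℝ, E) 𝓘(ℝ, E) ∞ hf.domChart.symm hf.domChart.target :=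
    contMDiffOn_symm_of_mem_maximalAtlas hf.domChart_mem_maximalAtlas
  have h2 : ContMDiffOn 𝓘(ℝ, E') 𝓘(ℝ, E') ∞ hf.codChart hf.codChart.source :=
    contMDiffOn_of_mem_maximalAtlas hf.codChart_mem_maximalAtlas
  have hm : ContMDiffOn (𝓘(ℝ, E').prod 𝓘(ℝ, hf.complement)) 𝓘(ℝ, E) ∞
      (fun p : Y × hf.complement => hf.equiv.symm (hf.codChart p.1, p.2))
      (hf.codChart.source ×ˢ univ) := by
    have h3 : ContMDiffOn (𝓘(ℝ, E').prod 𝓘(ℝ, hf.complement)) 𝓘(ℝ, E' × hf.complement) ∞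
        (fun p : Y × hf.complement => (hf.codChart p.1, p.2)) (hf.codChart.source ×ˢ univ) :=
      (h2.comp contMDiffOn_fst fun p hp => hp.1).prodMk_space contMDiffOn_snd
    exact hf.equiv.symm.contDiff.contMDiff.comp_contMDiffOn h3
  refine ⟨hf.complement, inferInstance, inferInstance, hf.domChart.source,
    (hf.codChart.source ×ˢ univ) ∩
      (fun p => hf.equiv.symm (hf.codChart p.1, p.2)) ⁻¹' hf.domChart.target,
    fun g => (hf.equiv (hf.domChart g)).2,
    fun p => hf.domChart.symm (hf.equiv.symm (hf.codChart p.1, p.2)),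
    hf.domChart.open_source, ?_, hf.mem_domChart_source, ?_, ?_, ?_, ?_⟩
  · exact hm.continuousOn.isOpen_inter_preimage (hf.codChart.open_source.prod isOpen_univ)
      hf.domChart.open_target
  · exact hf.equiv.contDiff.snd.contMDiff.comp_contMDiffOn h1
  · exact h1'.comp (hm.mono inter_subset_left) fun p hp => hp.2
  · intro g hg
    have h4 : hf.equiv.symm (hf.codChart (f g), (hf.equiv (hf.domChart g)).2)
        = hf.domChart g := by rw [hw' g hg]; simp
    refine ⟨⟨⟨hf.source_subset_preimage_source hg, mem_univ _⟩, ?_⟩, ?_⟩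
    · rw [mem_preimage, h4]
      exact hf.domChart.map_source hg
    · beta_reduce
      rw [h4, hf.domChart.left_inv hg]
  · rintro p ⟨⟨hp1, -⟩, hp2⟩
    refine hf.codChart.injOn
      (hf.source_subset_preimage_source (hf.domChart.map_target hp2)) hp1 ?_
    rw [hw _ hp2]
    simp

end NormalForms

namespace LieGroupoid

variable {EG : Type u} {EM : Type*}
  [NormedAddCommGroup EG] [NormedSpace ℝ EG]
  [NormedAddCommGroup EM] [NormedSpace ℝ EM]
  {G M : Type*}
  [TopologicalSpace G] [ChartedSpace EG G]
  [TopologicalSpace M] [ChartedSpace EM M]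

/-- Near a unit, the source map of a Lie groupoid is trivialized in such a way that the units form
the zero section. -/
theorem exists_trivialization_src (𝒢 : LieGroupoid EG EM G M) (p : M) :
    ∃ (F : Type u) (_ : NormedAddCommGroup F) (_ : NormedSpace ℝ F) (W : Set G) (Q : Set (M × F))
      (f : G → F) (ψ : M × F → G), IsOpen W ∧ IsOpen Q ∧ 𝒢.one p ∈ W ∧
      ContMDiffOn 𝓘(ℝ, EG) 𝓘(ℝ, F) ∞ f W ∧
      ContMDiffOn (𝓘(ℝ, EM).prod 𝓘(ℝ, F)) 𝓘(ℝ, EG) ∞ ψ Q ∧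
      (∀ g ∈ W, ψ (𝒢.src g, f g) = g) ∧ (∀ q ∈ Q, 𝒢.src (ψ q) = q.1) ∧
      (∀ x, f (𝒢.one x) = 0) ∧ ∀ x, 𝒢.one x ∈ W → (x, 0) ∈ Q := by
  obtain ⟨F, _, _, W, Q, f, ψ, hW, hQ, hpW, hf, hψ, hinv, hsec⟩ :=
    (𝒢.isSubmersion_src.isSubmersionAt (𝒢.one p)).exists_trivialization
  have hsrc : ContMDiff 𝓘(ℝ, EG) 𝓘(ℝ, EM) ∞ 𝒢.src := 𝒢.isSubmersion_src.contMDiff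
  have hos : ContMDiff 𝓘(ℝ, EG) 𝓘(ℝ, EG) ∞ (fun g => 𝒢.one (𝒢.src g)) :=
    𝒢.contMDiff_one.comp hsrc
  have hsh : ContMDiffOn (𝓘(ℝ, EM).prod 𝓘(ℝ, F)) (𝓘(ℝ, EM).prod 𝓘(ℝ, F)) ∞
      (fun q : M × F => (q.1, q.2 + f (𝒢.one q.1))) ((𝒢.one ⁻¹' W) ×ˢ univ) := by
    refine contMDiffOn_fst.prodMk (contMDiffOn_snd.add ?_)
    exact hf.comp (𝒢.contMDiff_one.contMDiffOn.comp contMDiffOn_fst (subset_preimage_univ))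
      fun q hq => hq.1
  -- Subtracting from the fibre coordinate of `g` that of the unit at `src g` moves the units to the
  -- zero section; `W` is shrunk so that this unit also lies in the trivialized region.
  refine ⟨F, inferInstance, inferInstance, W ∩ (fun g => 𝒢.one (𝒢.src g)) ⁻¹' W,
    ((𝒢.one ⁻¹' W) ×ˢ univ) ∩ (fun q : M × F => (q.1, q.2 + f (𝒢.one q.1))) ⁻¹' Q,
    fun g => f g - f (𝒢.one (𝒢.src g)), fun q => ψ (q.1, q.2 + f (𝒢.one q.1)),
    hW.inter (hW.preimage hos.continuous), ?_, ?_, ?_, ?_, ?_, ?_, ?_, ?_⟩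
  · exact hsh.continuousOn.isOpen_inter_preimage
      ((hW.preimage 𝒢.contMDiff_one.continuous).prod isOpen_univ) hQ
  · simp [hpW, 𝒢.src_one]
  · exact (hf.mono inter_subset_left).sub (hf.comp hos.contMDiffOn fun g hg => hg.2)
  · exact hψ.comp (hsh.mono inter_subset_left) fun q hq => hq.2
  · intro g hg
    simpa using (hinv g hg.1).2
  · intro q hq
    exact hsec _ hq.2
  · simp [𝒢.src_one]
  · intro x hx
    refine ⟨⟨hx.1, mem_univ _⟩, ?_⟩
    have := (hinv _ hx.1).1
    rw [𝒢.src_one] at this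
    simpa using this

end LieGroupoid

/-! ### Groupoid algebra and families of bisections. -/

namespace LieGroupoid

variable {EN EG EM : Type*}
  [NormedAddCommGroup EN] [NormedSpace ℝ EN]
  [NormedAddCommGroup EG] [NormedSpace ℝ EG]
  [NormedAddCommGroup EM] [NormedSpace ℝ EM]
  {N G M : Type*}
  [TopologicalSpace N] [ChartedSpace EN N]
  [TopologicalSpace G] [ChartedSpace EG G]
  [TopologicalSpace M] [ChartedSpace EM M]

section Algebra

variable (𝒢 : LieGroupoid EG EM G M)

theorem inv_one (x : M) : 𝒢.inv (𝒢.one x) = 𝒢.one x := by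
  have h1 := 𝒢.mul_one (𝒢.inv (𝒢.one x))
  rw [𝒢.src_inv, 𝒢.tgt_one, 𝒢.inv_mul, 𝒢.src_one] at h1
  exact h1.symm

theorem mul_inv_cancel_right {g h : G} (hgh : 𝒢.src g = 𝒢.tgt h) :
    𝒢.mul (𝒢.mul g h) (𝒢.inv h) = g := by
  rw [𝒢.mul_assoc _ _ _ hgh (𝒢.tgt_inv h).symm, 𝒢.mul_inv, ← hgh, 𝒢.mul_one]

theorem inv_mul_cancel_right {g h : G} (hgh : 𝒢.src g = 𝒢.src h) :
    𝒢.mul (𝒢.mul g (𝒢.inv h)) h = g := by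
  rw [𝒢.mul_assoc _ _ _ (by rw [𝒢.tgt_inv, hgh]) (𝒢.src_inv h), 𝒢.inv_mul, ← hgh, 𝒢.mul_one]

theorem inv_mul_cancel_left {g h : G} (hgh : 𝒢.src g = 𝒢.tgt h) :
    𝒢.mul (𝒢.inv g) (𝒢.mul g h) = h := by
  rw [← 𝒢.mul_assoc _ _ _ (𝒢.src_inv g) hgh, 𝒢.inv_mul, hgh, 𝒢.one_mul]

/-- Conjugation by arrows can be undone by conjugation with their inverses. -/
theorem conj_inv_conj {a b g : G} (hag : 𝒢.src a = 𝒢.tgt g) (hgb : 𝒢.src g = 𝒢.src b) :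
    𝒢.mul (𝒢.mul (𝒢.inv a) (𝒢.mul (𝒢.mul a g) (𝒢.inv b))) (𝒢.inv (𝒢.inv b)) = g := by
  have hgb' : 𝒢.src g = 𝒢.tgt (𝒢.inv b) := by rw [hgb, 𝒢.tgt_inv]
  have h1 : 𝒢.src a = 𝒢.tgt (𝒢.mul g (𝒢.inv b)) := by rw [𝒢.tgt_mul _ _ hgb', hag]
  rw [𝒢.mul_assoc _ _ _ hag hgb', 𝒢.inv_mul_cancel_left h1, 𝒢.mul_inv_cancel_right hgb']

theorem tgt_conj {a b g : G} (hag : 𝒢.src a = 𝒢.tgt g) (hgb : 𝒢.src g = 𝒢.src b) :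
    𝒢.tgt (𝒢.mul (𝒢.mul a g) (𝒢.inv b)) = 𝒢.tgt a := by
  rw [𝒢.tgt_mul _ _ (by rw [𝒢.src_mul _ _ hag, 𝒢.tgt_inv, hgb]), 𝒢.tgt_mul _ _ hag]

theorem contMDiff_src : ContMDiff 𝓘(ℝ, EG) 𝓘(ℝ, EM) ∞ 𝒢.src := 𝒢.isSubmersion_src.contMDiff

theorem contMDiff_tgt : ContMDiff 𝓘(ℝ, EG) 𝓘(ℝ, EM) ∞ 𝒢.tgt := 𝒢.isSubmersion_tgt.contMDiff

variable {𝒢} in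
-- Multiplication is smooth only within the set of composable pairs; composability on a whole
-- neighbourhood turns this into smoothness at the point.
theorem _root_.ContMDiffAt.groupoid_mul {E H X : Type*} [NormedAddCommGroup E] [NormedSpace ℝ E]
    [TopologicalSpace H] {I : ModelWithCorners ℝ E H} [TopologicalSpace X] [ChartedSpace H X]
    {u v : X → G} {x : X} (hu : ContMDiffAt I 𝓘(ℝ, EG) ∞ u x) (hv : ContMDiffAt I 𝓘(ℝ, EG) ∞ v x)
    (h : ∀ᶠ y in 𝓝 x, 𝒢.src (u y) = 𝒢.tgt (v y)) :
    ContMDiffAt I 𝓘(ℝ, EG) ∞ (fun y => 𝒢.mul (u y) (v y)) x := by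
  have h1 : ContMDiffWithinAt I 𝓘(ℝ, EG) ∞ (fun y => 𝒢.mul (u y) (v y))
      {y | 𝒢.src (u y) = 𝒢.tgt (v y)} x :=
    (𝒢.contMDiffOn_mul (u x, v x) h.self_of_nhds).comp (f := fun y => (u y, v y)) x
      (hu.prodMk hv).contMDiffWithinAt fun y hy => hy
  exact h1.contMDiffAt h

end Algebra

/-- A smooth family of bisections, parametrized by `(-δ, δ)`, through the identity bisection. -/
structure IsBisectionFamily (𝒢 : LieGroupoid EG EM G M) (δ : ℝ) (σ : ℝ → M → G) : Prop where
  contMDiffOn : ContMDiffOn (𝓘(ℝ, EM).prod 𝓘(ℝ, ℝ)) 𝓘(ℝ, EG) ∞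
    (fun p : M × ℝ => σ p.2 p.1) (univ ×ˢ Ioo (-δ) δ)
  isBisection : ∀ ε ∈ Ioo (-δ) δ, 𝒢.IsBisection (σ ε)
  zero : σ 0 = 𝒢.one

/-- A smooth family of maps `N → G`, parametrized by `(-δ, δ)`, that starts at the units over
`φ₀`. -/
structure IsGaugeFamily (𝒢 : LieGroupoid EG EM G M) (φ₀ : N → M) (δ : ℝ) (θ : ℝ → N → G) :
    Prop where
  contMDiffOn : ContMDiffOn (𝓘(ℝ, EN).prod 𝓘(ℝ, ℝ)) 𝓘(ℝ, EG) ∞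
    (fun p : N × ℝ => θ p.2 p.1) (univ ×ˢ Ioo (-δ) δ)
  zero : ∀ x, θ 0 x = 𝒢.one (φ₀ x)

variable {𝒢 : LieGroupoid EG EM G M} {φ₀ : N → M}

namespace IsBisectionFamily

theorem mono {δ δ' : ℝ} {σ : ℝ → M → G} (h : 𝒢.IsBisectionFamily δ σ) (hδ : δ' ≤ δ) :
    𝒢.IsBisectionFamily δ' σ :=
  ⟨h.contMDiffOn.mono (prod_mono_right (Ioo_neg_subset_Ioo_neg hδ)),
    fun ε hε => h.isBisection ε (Ioo_neg_subset_Ioo_neg hδ hε), h.zero⟩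

theorem one (δ : ℝ) : 𝒢.IsBisectionFamily δ fun _ => 𝒢.one :=
  ⟨(𝒢.contMDiff_one.comp contMDiff_fst).contMDiffOn,
    fun _ _ => ⟨𝒢.contMDiff_one, 𝒢.src_one, Diffeomorph.refl _ _ _, fun x => (𝒢.tgt_one x).symm⟩,
    rfl⟩

/-- The pointwise product of bisections. -/
theorem mul {δ : ℝ} {ρ σ : ℝ → M → G} (hρ : 𝒢.IsBisectionFamily δ ρ)
    (hσ : 𝒢.IsBisectionFamily δ σ) :
    𝒢.IsBisectionFamily δ fun ε y => 𝒢.mul (ρ ε (𝒢.tgt (σ ε y))) (σ ε y) := by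
  have hcomp : ∀ ε ∈ Ioo (-δ) δ, ∀ y, 𝒢.src (ρ ε (𝒢.tgt (σ ε y))) = 𝒢.tgt (σ ε y) :=
    fun ε hε y => (hρ.isBisection ε hε).src_apply _
  have hsm : ContMDiffOn (𝓘(ℝ, EM).prod 𝓘(ℝ, ℝ)) 𝓘(ℝ, EG) ∞
      (fun p : M × ℝ => 𝒢.mul (ρ p.2 (𝒢.tgt (σ p.2 p.1))) (σ p.2 p.1))
      (univ ×ˢ Ioo (-δ) δ) := by
    rintro ⟨y, ε⟩ ⟨-, hε⟩
    refine ContMDiffAt.contMDiffWithinAt (ContMDiffAt.groupoid_mul ?_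
      (hσ.contMDiffOn.contMDiffAt_family isOpen_Ioo y hε) ?_)
    · exact ContMDiffAt.comp (g := fun p : M × ℝ => ρ p.2 p.1)
        (f := fun p : M × ℝ => (𝒢.tgt (σ p.2 p.1), p.2)) (y, ε)
        (hρ.contMDiffOn.contMDiffAt_family isOpen_Ioo _ hε)
        ((ContMDiffAt.comp (g := 𝒢.tgt) (y, ε) 𝒢.contMDiff_tgt.contMDiffAt
          (hσ.contMDiffOn.contMDiffAt_family isOpen_Ioo y hε)).prodMk contMDiffAt_snd)
    · filter_upwards [univ_prod_mem_nhds isOpen_Ioo hε] with p hp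
      exact hcomp p.2 hp.2 p.1
  refine ⟨hsm, fun ε hε => ⟨?_, fun x => ?_, ?_⟩, ?_⟩
  · exact hsm.contMDiff_family_apply
      (u := fun ε y => 𝒢.mul (ρ ε (𝒢.tgt (σ ε y))) (σ ε y)) isOpen_Ioo hε
  · rw [𝒢.src_mul _ _ (hcomp ε hε x), (hσ.isBisection ε hε).src_apply]
  · obtain ⟨f, hf⟩ := (hσ.isBisection ε hε).exists_diffeomorph
    obtain ⟨k, hk⟩ := (hρ.isBisection ε hε).exists_diffeomorph
    refine ⟨f.trans k, fun x => ?_⟩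
    rw [𝒢.tgt_mul _ _ (hcomp ε hε x), Diffeomorph.coe_trans, Function.comp_apply, hf, hk]
  · funext y
    rw [hρ.zero, hσ.zero, 𝒢.tgt_one]
    simpa only [𝒢.tgt_one] using 𝒢.one_mul (𝒢.one y)

end IsBisectionFamily

/-! ### The extension property and its multiplicative patching. -/

variable (𝒢 φ₀) in
/-- Every gauge family is, over the set `S` and wherever it consists of units, induced by a family
of global bisections. -/
def HasBisectionExtension (EN : Type*) [NormedAddCommGroup EN] [NormedSpace ℝ EN]
    [ChartedSpace EN N] (S : Set N) : Prop :=
  ∀ δ > 0, ∀ θ : ℝ → N → G, IsGaugeFamily (EN := EN) 𝒢 φ₀ δ θ →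
    ∃ δ' > 0, δ' ≤ δ ∧ ∃ σ, 𝒢.IsBisectionFamily δ' σ ∧ ∀ ε ∈ Ioo (-δ') δ', ∀ x,
      (x ∈ S ∨ θ ε x = 𝒢.one (𝒢.src (θ ε x))) → σ ε (𝒢.src (θ ε x)) = θ ε x

namespace HasBisectionExtension

theorem empty : 𝒢.HasBisectionExtension φ₀ EN (∅ : Set N) := fun δ hδ _ _ =>
  ⟨δ, hδ, le_rfl, _, IsBisectionFamily.one δ, fun _ _ _ hx =>
    (hx.resolve_left (notMem_empty _)).symm⟩

theorem mono {S T : Set N} (hST : S ⊆ T) (hT : 𝒢.HasBisectionExtension φ₀ EN T) :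
    𝒢.HasBisectionExtension φ₀ EN S := fun δ hδ θ hθ => by
  obtain ⟨δ', hδ', hle, σ, hσ, h⟩ := hT δ hδ θ hθ
  exact ⟨δ', hδ', hle, σ, hσ, fun ε hε x hx => h ε hε x (hx.imp_left fun h => hST h)⟩

/-- Extend `θ` over `S` by `σ`, then extend the quotient `θ' = θ σ⁻¹` over `T` by `ρ`; the product
`ρ σ` extends `θ` over both. On `S`, and wherever `θ` is a unit, `θ'` is a unit, so the clause on
units in `HasBisectionExtension` prevents `ρ` from spoiling what `σ` achieved. -/
theorem union {S T : Set N} (hS : 𝒢.HasBisectionExtension φ₀ EN S)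
    (hT : 𝒢.HasBisectionExtension φ₀ EN T) : 𝒢.HasBisectionExtension φ₀ EN (S ∪ T) := by
  intro δ hδ θ hθ
  obtain ⟨δ₁, hδ₁, hle₁, σ, hσ, hσθ⟩ := hS δ hδ θ hθ
  set θ' : ℝ → N → G := fun ε x => 𝒢.mul (θ ε x) (𝒢.inv (σ ε (𝒢.src (θ ε x)))) with hθ'
  have hsσ : ∀ ε ∈ Ioo (-δ₁) δ₁, ∀ x, 𝒢.src (σ ε (𝒢.src (θ ε x))) = 𝒢.src (θ ε x) :=
    fun ε hε x => (hσ.isBisection ε hε).src_apply _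
  have hθ'g : IsGaugeFamily (EN := EN) 𝒢 φ₀ δ₁ θ' := by
    constructor
    · rintro ⟨x, ε⟩ ⟨-, hε⟩
      have hθx := hθ.contMDiffOn.contMDiffAt_family isOpen_Ioo x (Ioo_neg_subset_Ioo_neg hle₁ hε)
      refine ContMDiffAt.contMDiffWithinAt (ContMDiffAt.groupoid_mul hθx
        (ContMDiffAt.comp (g := 𝒢.inv) (x, ε) 𝒢.contMDiff_inv.contMDiffAt ?_) ?_)
      · exact ContMDiffAt.comp (g := fun p : M × ℝ => σ p.2 p.1)
          (f := fun p : N × ℝ => (𝒢.src (θ p.2 p.1), p.2)) (x, ε)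
          (hσ.contMDiffOn.contMDiffAt_family isOpen_Ioo _ hε)
          ((ContMDiffAt.comp (g := 𝒢.src) (x, ε) 𝒢.contMDiff_src.contMDiffAt hθx).prodMk
            contMDiffAt_snd)
      · filter_upwards [univ_prod_mem_nhds isOpen_Ioo hε] with p hp
        rw [𝒢.tgt_inv, hsσ p.2 hp.2]
    · intro x
      simp only [hθ', hθ.zero, hσ.zero, 𝒢.src_one, 𝒢.inv_one]
      simpa only [𝒢.tgt_one] using 𝒢.one_mul (𝒢.one (φ₀ x))
  obtain ⟨δ₂, hδ₂, hle₂, ρ, hρ, hρθ⟩ := hT δ₁ hδ₁ θ' hθ'g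
  refine ⟨δ₂, hδ₂, hle₂.trans hle₁, _, hρ.mul (hσ.mono hle₂), fun ε hε x hx => ?_⟩
  have hε₁ := Ioo_neg_subset_Ioo_neg hle₂ hε
  have hsrc' : 𝒢.src (θ' ε x) = 𝒢.tgt (σ ε (𝒢.src (θ ε x))) := by
    simp only [hθ']
    rw [𝒢.src_mul _ _ (by rw [𝒢.tgt_inv, hsσ ε hε₁]), 𝒢.src_inv]
  have hρx : ρ ε (𝒢.src (θ' ε x)) = θ' ε x := by
    by_cases hxT : x ∈ T
    · exact hρθ ε hε x (Or.inl hxT)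
    · refine hρθ ε hε x (Or.inr ?_)
      have hx' : x ∈ S ∨ θ ε x = 𝒢.one (𝒢.src (θ ε x)) := by
        rcases hx with (h | h) | h
        · exact Or.inl h
        · exact (hxT h).elim
        · exact Or.inr h
      rw [hsrc']
      simp only [hθ']
      rw [hσθ ε hε₁ x hx', 𝒢.mul_inv]
  -- The product at `src (θ ε x)` is now `θ' σ = (θ σ⁻¹) σ = θ`.
  rw [← hsrc', hρx]
  exact 𝒢.inv_mul_cancel_right (hsσ ε hε₁ x).symm

end HasBisectionExtension

end LieGroupoid

/-! ### Left inverses for a moving family of maps. -/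

section LocalInverse

variable {E E' : Type*} [NormedAddCommGroup E] [NormedSpace ℝ E] [FiniteDimensional ℝ E]
  [NormedAddCommGroup E'] [NormedSpace ℝ E']
  {X Y : Type*} [TopologicalSpace X] [ChartedSpace E X] [TopologicalSpace Y] [ChartedSpace E' Y]

/-- Let `q` be a left inverse, in a chart `a`, of the member at `0` of a smooth family of maps `φ`.
After correction by a smooth family `l` it is a left inverse, near a given point, of all members
with small parameter. -/
theorem exists_leftInverse_family {a : OpenPartialHomeomorph X E}
    (ha : a ∈ IsManifold.maximalAtlas 𝓘(ℝ, E) ∞ X) {U : Set Y} (hU : IsOpen U) {q : Y → E}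
    (hq : ContMDiffOn 𝓘(ℝ, E') 𝓘(ℝ, E) ∞ q U) {z₀ : E} (χ : SmoothBumpFunction 𝓘(ℝ, E) z₀)
    (hχ : tsupport χ ⊆ a.target) {φ : ℝ → X → Y} {δ : ℝ} (hδ : 0 < δ)
    (hφ : ContMDiffOn (𝓘(ℝ, E).prod 𝓘(ℝ, ℝ)) 𝓘(ℝ, E') ∞ (fun p : X × ℝ => φ p.2 p.1)
      (univ ×ˢ Ioo (-δ) δ))
    (hqφ : ∀ x ∈ a.source, φ 0 x ∈ U ∧ q (φ 0 x) = a x) :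
    ∃ δ' > 0, δ' ≤ δ ∧ ∃ l : ℝ → E → E,
      ContDiffOn ℝ ∞ (fun p : E × ℝ => l p.2 p.1) (univ ×ˢ Ioo (-δ') δ') ∧
      (∀ z, l 0 z = z) ∧
      ∀ ε ∈ Ioo (-δ') δ', ∀ x ∈ a.source, χ (a x) = 1 → l ε (q (φ ε x)) = a x := by
  have h0mem : (0 : ℝ) ∈ Ioo (-δ) δ := ⟨by linarith, hδ⟩
  have hasymm : ∀ z ∈ a.target, ContMDiffAt 𝓘(ℝ, E) 𝓘(ℝ, E) ∞ a.symm z := fun z hz =>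
    (contMDiffOn_symm_of_mem_maximalAtlas ha).contMDiffAt (a.open_target.mem_nhds hz)
  have hφa : ∀ z ∈ a.target, ∀ ε ∈ Ioo (-δ) δ, ContMDiffAt (𝓘(ℝ, E).prod 𝓘(ℝ, ℝ)) 𝓘(ℝ, E') ∞
      (fun p : E × ℝ => φ p.2 (a.symm p.1)) (z, ε) := fun z hz ε hε =>
    ContMDiffAt.comp (g := fun p : X × ℝ => φ p.2 p.1) (f := fun p : E × ℝ => (a.symm p.1, p.2))
      (z, ε) (hφ.contMDiffAt_family isOpen_Ioo _ hε)
      ((ContMDiffAt.comp (g := a.symm) (z, ε) (hasymm z hz) contMDiffAt_fst).prodMk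
        contMDiffAt_snd)
  have hK : IsCompact (tsupport χ) := χ.hasCompactSupport
  obtain ⟨δ₁, hδ₁, hUK⟩ := hK.exists_pos_forall_abs_lt (P := fun z ε => φ ε (a.symm z) ∈ U)
    (fun z hz => (hφa z (hχ hz) 0 h0mem).continuousAt.eventually
      (hU.mem_nhds (hqφ _ (a.map_target (hχ hz))).1))
  have hle := Ioo_neg_subset_Ioo_neg (min_le_right δ₁ δ)
  have hle₁ := Ioo_neg_subset_Ioo_neg (min_le_left δ₁ δ)
  set δ₂ := min δ₁ δ with hδ₂
  have hδ₂pos : 0 < δ₂ := lt_min hδ₁ hδ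
  -- Where `χ = 1`, `z + g ε z` is `q ∘ φ ε` read in the chart `a`; inverting it corrects `q`. The
  -- cutoff makes the perturbation compactly supported, and it vanishes at `ε = 0` because `q ∘ φ 0
  -- = a`.
  set g : ℝ → E → E := fun ε z => χ z • (q (φ ε (a.symm z)) - z) with hg
  have hgK : ∀ ε ∈ Ioo (-δ₂) δ₂, ∀ z ∉ tsupport χ, g ε z = 0 := fun ε _ z hz => by
    simp only [hg]
    rw [image_eq_zero_of_notMem_tsupport hz, zero_smul]
  have hgsm : ContDiffOn ℝ ∞ (fun p : E × ℝ => g p.2 p.1) (univ ×ˢ Ioo (-δ₂) δ₂) := by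
    rintro ⟨z, ε⟩ ⟨-, hε⟩
    refine ContDiffAt.contDiffWithinAt ?_
    by_cases hz : z ∈ tsupport χ
    · have h1 : ContMDiffAt (𝓘(ℝ, E).prod 𝓘(ℝ, ℝ)) 𝓘(ℝ, E) ∞
          (fun p : E × ℝ => q (φ p.2 (a.symm p.1))) (z, ε) :=
        ContMDiffAt.comp (g := q) (z, ε) (hq.contMDiffAt (hU.mem_nhds (hUK ε (hle₁ hε) z hz)))
          (hφa z (hχ hz) ε (hle hε))
      have h2 : ContDiffAt ℝ ∞ (fun p : E × ℝ => χ p.1) (z, ε) :=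
        χ.contMDiff.contDiff.contDiffAt.comp (f := Prod.fst) (z, ε) contDiffAt_fst
      exact h2.smul ((contMDiffAt_prod_self_iff.1 h1).sub contDiffAt_fst)
    · refine (contDiffAt_const (c := (0 : E))).congr_of_eventuallyEq ?_
      filter_upwards [(hK.isClosed.isOpen_compl.prod isOpen_Ioo).mem_nhds
        (show (z, ε) ∈ (tsupport χ)ᶜ ×ˢ Ioo (-δ₂) δ₂ from ⟨hz, hε⟩)] with p hp
      exact hgK _ hp.2 _ hp.1
  have hg0 : ∀ z, g 0 z = 0 := by
    intro z
    by_cases hz : z ∈ tsupport χ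
    · simp only [hg]
      rw [(hqφ _ (a.map_target (hχ hz))).2, a.right_inv (hχ hz), sub_self, smul_zero]
    · exact hgK 0 ⟨by linarith, hδ₂pos⟩ z hz
  obtain ⟨δ₃, hδ₃, hδ₃le, l, hl, hlinv⟩ := exists_contDiffOn_inverse_add hδ₂pos hgsm hg0 hK hgK
  refine ⟨δ₃, hδ₃, hδ₃le.trans (min_le_right _ _), l, hl, fun z => ?_, fun ε hε x hx hχx => ?_⟩
  · exact ((hlinv 0 ⟨by linarith, hδ₃⟩ z z).1 (by rw [hg0, add_zero])).symm
  · refine ((hlinv ε hε (a x) _).1 ?_).symm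
    simp only [hg]
    rw [hχx, a.left_inv hx, one_smul, add_sub_cancel]

end LocalInverse

/-! ### Extending gauge families to families of bisections. -/

namespace LieGroupoid

variable {EN EG EM : Type*}
  [NormedAddCommGroup EN] [NormedSpace ℝ EN] [FiniteDimensional ℝ EN]
  [NormedAddCommGroup EG] [NormedSpace ℝ EG]
  [NormedAddCommGroup EM] [NormedSpace ℝ EM] [FiniteDimensional ℝ EM]
  {N G M : Type*}
  [TopologicalSpace N] [ChartedSpace EN N] [T2Space N] [CompactSpace N]
  [TopologicalSpace G] [ChartedSpace EG G]
  [TopologicalSpace M] [ChartedSpace EM M] [IsManifold 𝓘(ℝ, EM) ∞ M] [T2Space M]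
  {𝒢 : LieGroupoid EG EM G M} {φ₀ : N → M}

/-- The neighbourhood `S` must be fixed before the gauge family is given, so all choices of charts
and cutoffs depend on `φ₀` and `x₀` alone; only the bounds on `ε` depend on `θ`. -/
theorem exists_mem_nhds_hasBisectionExtension (hφ₀ : Continuous φ₀)
    (hinj : Function.Injective φ₀) {x₀ : N}
    (himm : Manifold.IsImmersionAt 𝓘(ℝ, EN) 𝓘(ℝ, EM) ∞ φ₀ x₀) :
    ∃ S ∈ 𝓝 x₀, 𝒢.HasBisectionExtension φ₀ EN S := by
  classical
  obtain ⟨a, ha, hx₀a, U, hU, q, hq, hqa⟩ := himm.exists_chart_eq_comp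
  obtain ⟨F, _, _, W, Q, f, ψ, hW, hQ, hpW, hf, hψ, hψf, hsψ, hf1, hQ1⟩ :=
    𝒢.exists_trivialization_src (φ₀ x₀)
  have hψ1 : ∀ y, 𝒢.one y ∈ W → ψ (y, 0) = 𝒢.one y := by
    intro y hy
    have h := hψf _ hy
    rwa [𝒢.src_one, hf1] at h
  have hasymm : ∀ z ∈ a.target, ContMDiffAt 𝓘(ℝ, EN) 𝓘(ℝ, EN) ∞ a.symm z := fun z hz =>
    (contMDiffOn_symm_of_mem_maximalAtlas ha).contMDiffAt (a.open_target.mem_nhds hz)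
  obtain ⟨χ, -, hχ⟩ := (SmoothBumpFunction.nhds_basis_tsupport (I := 𝓘(ℝ, EN)) (a x₀)).mem_iff.1
    (a.open_target.mem_nhds (a.map_source hx₀a))
  -- On `O` the corrected left inverse recovers the point exactly.
  set O : Set N := a.source ∩ a ⁻¹' interior {z | χ z = 1} with hO
  have hOo : IsOpen O := a.isOpen_inter_preimage isOpen_interior
  have hx₀O : x₀ ∈ O := ⟨hx₀a, mem_interior_iff_mem_nhds.2 χ.eventuallyEq_one⟩
  have hOc : IsCompact Oᶜ := hOo.isClosed_compl.isCompact
  set R : Set EN := a.target ∩ a.symm ⁻¹' ((fun x => 𝒢.one (φ₀ x)) ⁻¹' W) with hR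
  have hRo : IsOpen R := a.isOpen_inter_preimage_symm
    (hW.preimage (𝒢.contMDiff_one.continuous.comp hφ₀))
  -- `V` avoids the image of the complement of `O`, which is compact and, by injectivity, misses `φ₀
  -- x₀`. The other conditions make the formula for `σ` below meaningful at `ε = 0`.
  set V : Set M := (φ₀ '' Oᶜ)ᶜ ∩ 𝒢.one ⁻¹' W ∩ (U ∩ q ⁻¹' R) with hV
  have hVo : IsOpen V := ((hOc.image hφ₀).isClosed.isOpen_compl.inter
    (hW.preimage 𝒢.contMDiff_one.continuous)).inter (hq.continuousOn.isOpen_inter_preimage hU hRo)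
  have hx₀V : φ₀ x₀ ∈ V := by
    refine ⟨⟨?_, hpW⟩, (hqa x₀ hx₀a).1, ?_⟩
    · rintro ⟨x, hx, hxx⟩
      exact hx (hinj hxx ▸ hx₀O)
    · rw [mem_preimage, (hqa x₀ hx₀a).2]
      refine ⟨a.map_source hx₀a, ?_⟩
      rw [mem_preimage, a.left_inv hx₀a]
      exact hpW
  obtain ⟨χM, -, hχM⟩ := (SmoothBumpFunction.nhds_basis_tsupport (I := 𝓘(ℝ, EM)) (φ₀ x₀)).mem_iff.1
    (hVo.mem_nhds hx₀V)
  have hKM : IsCompact (tsupport χM) := χM.hasCompactSupport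
  have hχMone : {y | χM y = 1} ⊆ tsupport χM := fun y hy =>
    subset_tsupport _ (by rw [Function.mem_support, show χM y = 1 from hy]; exact one_ne_zero)
  obtain ⟨S, hS, hSsub, hSc⟩ := local_compact_nhds
    ((isOpen_interior.preimage hφ₀).mem_nhds
      (show x₀ ∈ φ₀ ⁻¹' interior {y | χM y = 1} from
        mem_interior_iff_mem_nhds.2 χM.eventuallyEq_one))
  refine ⟨S, hS, fun δ hδ θ hθ => ?_⟩
  have hθat := fun x ε hε => hθ.contMDiffOn.contMDiffAt_family isOpen_Ioo x (ε := ε) hε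
  have hφsm : ContMDiffOn (𝓘(ℝ, EN).prod 𝓘(ℝ, ℝ)) 𝓘(ℝ, EM) ∞
      (fun p : N × ℝ => 𝒢.src (θ p.2 p.1)) (univ ×ˢ Ioo (-δ) δ) :=
    𝒢.contMDiff_src.comp_contMDiffOn hθ.contMDiffOn
  have hφat := fun x ε hε => hφsm.contMDiffAt_family (u := fun ε x => 𝒢.src (θ ε x))
    isOpen_Ioo x (ε := ε) hε
  have hφ0 : ∀ x, 𝒢.src (θ 0 x) = φ₀ x := fun x => by rw [hθ.zero, 𝒢.src_one]
  have h0mem : (0 : ℝ) ∈ Ioo (-δ) δ := ⟨by linarith, hδ⟩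
  obtain ⟨δ₂, hδ₂, hδ₂le, l, hl, hl0, hlφ⟩ := exists_leftInverse_family ha hU hq χ hχ
    (φ := fun ε x => 𝒢.src (θ ε x)) hδ hφsm (fun x hx => by rw [hφ0]; exact hqa x hx)
  have h0mem₂ : (0 : ℝ) ∈ Ioo (-δ₂) δ₂ := ⟨by linarith, hδ₂⟩
  have hrsm : ∀ y ∈ U, ∀ ε ∈ Ioo (-δ₂) δ₂, ContMDiffAt (𝓘(ℝ, EM).prod 𝓘(ℝ, ℝ)) 𝓘(ℝ, EN) ∞
      (fun p : M × ℝ => l p.2 (q p.1)) (y, ε) := fun y hy ε hε =>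
    ContMDiffAt.comp (g := fun p : EN × ℝ => l p.2 p.1) (f := fun p : M × ℝ => (q p.1, p.2)) (y, ε)
      (contMDiffAt_prod_self_iff.2 (hl.contDiffAt (univ_prod_mem_nhds isOpen_Ioo hε)))
      ((ContMDiffAt.comp (g := q) (y, ε) (hq.contMDiffAt (hU.mem_nhds hy)) contMDiffAt_fst).prodMk
        contMDiffAt_snd)
  have hθrsm : ∀ y ∈ U, ∀ ε ∈ Ioo (-δ₂) δ₂, l ε (q y) ∈ a.target →
      ContMDiffAt (𝓘(ℝ, EM).prod 𝓘(ℝ, ℝ)) 𝓘(ℝ, EG) ∞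
        (fun p : M × ℝ => θ p.2 (a.symm (l p.2 (q p.1)))) (y, ε) := fun y hy ε hε hyt =>
    ContMDiffAt.comp (g := fun p : N × ℝ => θ p.2 p.1)
      (f := fun p : M × ℝ => (a.symm (l p.2 (q p.1)), p.2)) (y, ε)
      (hθat _ ε (Ioo_neg_subset_Ioo_neg hδ₂le hε))
      ((ContMDiffAt.comp (g := a.symm) (y, ε) (hasymm _ hyt) (hrsm y hy ε hε)).prodMk
        contMDiffAt_snd)
  -- The fibre coordinate of `θ` at the point of `N` that the left inverse assigns to `y`, cut off
  -- by `χM`.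
  set w : ℝ → M → F := fun ε y => χM y • f (θ ε (a.symm (l ε (q y)))) with hw
  have hwsm : ∀ y ∈ U, ∀ ε ∈ Ioo (-δ₂) δ₂, l ε (q y) ∈ a.target →
      θ ε (a.symm (l ε (q y))) ∈ W → ContMDiffAt (𝓘(ℝ, EM).prod 𝓘(ℝ, ℝ)) 𝓘(ℝ, F) ∞
        (fun p : M × ℝ => w p.2 p.1) (y, ε) := fun y hy ε hε hyt hyW =>
    (ContMDiffAt.comp (g := χM) (y, ε) χM.contMDiff.contMDiffAt contMDiffAt_fst).smul
      (ContMDiffAt.comp (g := f) (y, ε) (hf.contMDiffAt (hW.mem_nhds hyW)) (hθrsm y hy ε hε hyt))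
  have hwzero : ∀ ε, ∀ y ∉ tsupport χM, w ε y = 0 := fun ε y hy => by
    simp only [hw]
    rw [image_eq_zero_of_notMem_tsupport hy, zero_smul]
  have hw0 : ∀ y, w 0 y = 0 := fun y => by
    simp only [hw]
    rw [hθ.zero, hf1, smul_zero]
  obtain ⟨δ₃, hδ₃, hgood⟩ := hKM.exists_pos_forall_abs_lt (P := fun y ε =>
    (l ε (q y) ∈ a.target ∧ θ ε (a.symm (l ε (q y))) ∈ W) ∧ (y, w ε y) ∈ Q) (by
      intro y hy
      obtain ⟨⟨-, hyW⟩, hyU, hyR⟩ := hχM hy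
      have ht : l 0 (q y) ∈ a.target := by rw [hl0]; exact hyR.1
      have htW : θ 0 (a.symm (l 0 (q y))) ∈ W := by rw [hl0, hθ.zero]; exact hyR.2
      refine (((hrsm y hyU 0 h0mem₂).continuousAt.eventually (a.open_target.mem_nhds ht)).and
        ((hθrsm y hyU 0 h0mem₂ ht).continuousAt.eventually (hW.mem_nhds htW))).and ?_
      have hc : ContinuousAt (fun p : M × ℝ => (p.1, w p.2 p.1)) (y, 0) :=
        continuousAt_fst.prodMk (hwsm y hyU 0 h0mem₂ ht htW).continuousAt
      refine hc.eventually (hQ.mem_nhds ?_)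
      simp only [hw0]
      exact hQ1 y hyW)
  -- For small `ε`, no point outside `O` is sent into the support of `χM`, where the left inverse
  -- would recover the wrong point.
  obtain ⟨δ₄, hδ₄, havoid⟩ := hOc.exists_pos_forall_abs_lt
    (P := fun x ε => 𝒢.src (θ ε x) ∈ (tsupport χM)ᶜ) (fun x hx =>
      (hφat x 0 h0mem).continuousAt.eventually (hKM.isClosed.isOpen_compl.mem_nhds (by
        beta_reduce
        rw [hφ0]
        exact fun h => (hχM h).1.1 ⟨x, hx, rfl⟩)))
  obtain ⟨δ₅, hδ₅, hSε⟩ := hSc.exists_pos_forall_abs_lt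
    (P := fun x ε => 𝒢.src (θ ε x) ∈ interior {y | χM y = 1} ∧ θ ε x ∈ W) (fun x hx =>
      ((hφat x 0 h0mem).continuousAt.eventually (isOpen_interior.mem_nhds (by
        beta_reduce
        rw [hφ0]
        exact hSsub hx))).and
      ((hθat x 0 h0mem).continuousAt.eventually (hW.mem_nhds (by
        beta_reduce
        rw [hθ.zero]
        exact (hχM (hχMone (interior_subset (hSsub hx)))).1.2))))
  set δ₆ := min (min δ₂ δ₃) (min δ₄ δ₅) with hδ₆
  have hδ₆pos : 0 < δ₆ := lt_min (lt_min hδ₂ hδ₃) (lt_min hδ₄ hδ₅)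
  have hle₂ : δ₆ ≤ δ₂ := (min_le_left _ _).trans (min_le_left _ _)
  have hle₃ : δ₆ ≤ δ₃ := (min_le_left _ _).trans (min_le_right _ _)
  have hle₄ : δ₆ ≤ δ₄ := (min_le_right _ _).trans (min_le_left _ _)
  have hle₅ : δ₆ ≤ δ₅ := (min_le_right _ _).trans (min_le_right _ _)
  set σ : ℝ → M → G := fun ε y => if y ∈ tsupport χM then ψ (y, w ε y) else 𝒢.one y with hσ
  have hσin : ∀ ε y, y ∈ tsupport χM → σ ε y = ψ (y, w ε y) := fun ε y hy => if_pos hy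
  have hσout : ∀ ε y, y ∉ tsupport χM → σ ε y = 𝒢.one y := fun ε y hy => if_neg hy
  -- The two branches of `σ` agree wherever `one y ∈ W`, since `w` vanishes off the support; hence
  -- `σ` is smooth across the boundary.
  have hσψ : ∀ ε y, 𝒢.one y ∈ W → σ ε y = ψ (y, w ε y) := by
    intro ε y hy
    by_cases hyK : y ∈ tsupport χM
    · exact hσin ε y hyK
    · rw [hσout ε y hyK, hwzero ε y hyK, hψ1 y hy]
  have hσ0 : ∀ y, σ 0 y = 𝒢.one y := by
    intro y
    by_cases hyK : y ∈ tsupport χM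
    · rw [hσin 0 y hyK, hw0, hψ1 y (hχM hyK).1.2]
    · exact hσout 0 y hyK
  have hσsm : ContMDiffOn (𝓘(ℝ, EM).prod 𝓘(ℝ, ℝ)) 𝓘(ℝ, EG) ∞ (fun p : M × ℝ => σ p.2 p.1)
      (univ ×ˢ Ioo (-δ₆) δ₆) := by
    rintro ⟨y, ε⟩ ⟨-, hε⟩
    refine ContMDiffAt.contMDiffWithinAt ?_
    by_cases hyK : y ∈ tsupport χM
    · obtain ⟨⟨ht, htW⟩, hyQ⟩ := hgood ε (Ioo_neg_subset_Ioo_neg hle₃ hε) y hyK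
      have h1 : ContMDiffAt (𝓘(ℝ, EM).prod 𝓘(ℝ, ℝ)) 𝓘(ℝ, EG) ∞
          (fun p : M × ℝ => ψ (p.1, w p.2 p.1)) (y, ε) :=
        ContMDiffAt.comp (g := ψ) (f := fun p : M × ℝ => (p.1, w p.2 p.1)) (y, ε)
          (hψ.contMDiffAt (hQ.mem_nhds hyQ))
          (contMDiffAt_fst.prodMk
            (hwsm y (hχM hyK).2.1 ε (Ioo_neg_subset_Ioo_neg hle₂ hε) ht htW))
      refine h1.congr_of_eventuallyEq ?_
      filter_upwards [(𝒢.contMDiff_one.continuous.comp continuous_fst).continuousAt.eventually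
        (hW.mem_nhds (show 𝒢.one ((y, ε) : M × ℝ).1 ∈ W from (hχM hyK).1.2))] with p hp
      exact hσψ p.2 p.1 hp
    · refine (ContMDiffAt.comp (g := 𝒢.one) (f := Prod.fst) (y, ε) 𝒢.contMDiff_one.contMDiffAt
        contMDiffAt_fst).congr_of_eventuallyEq ?_
      filter_upwards [continuous_fst.continuousAt.eventually
        (hKM.isClosed.isOpen_compl.mem_nhds (show ((y, ε) : M × ℝ).1 ∈ (tsupport χM)ᶜ from hyK))]
        with p hp
      exact hσout p.2 p.1 hp
  have hsσ : ∀ ε ∈ Ioo (-δ₆) δ₆, ∀ y, 𝒢.src (σ ε y) = y := by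
    intro ε hε y
    by_cases hyK : y ∈ tsupport χM
    · rw [hσin ε y hyK, hsψ _ (hgood ε (Ioo_neg_subset_Ioo_neg hle₃ hε) y hyK).2]
    · rw [hσout ε y hyK, 𝒢.src_one]
  obtain ⟨δ₇, hδ₇, hle₇, hdiff⟩ := exists_diffeomorph_of_eq_self_off_compact
    (IsManifold.chart_mem_maximalAtlas (I := 𝓘(ℝ, EM)) (n := ∞) (φ₀ x₀)) hKM
    χM.tsupport_subset_chartAt_source (k := fun ε y => 𝒢.tgt (σ ε y)) hδ₆pos
    (𝒢.contMDiff_tgt.comp_contMDiffOn hσsm) (fun y => by rw [hσ0, 𝒢.tgt_one])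
    (fun ε _ y hy => by rw [hσout ε y hy, 𝒢.tgt_one])
  refine ⟨δ₇, hδ₇, hle₇.trans (hle₂.trans hδ₂le), σ, ⟨?_, fun ε hε => ?_, funext hσ0⟩, ?_⟩
  · exact hσsm.mono (prod_mono_right (Ioo_neg_subset_Ioo_neg hle₇))
  · have hε₆ := Ioo_neg_subset_Ioo_neg hle₇ hε
    exact ⟨hσsm.contMDiff_family_apply isOpen_Ioo hε₆, hsσ ε hε₆, hdiff ε hε⟩
  · intro ε hε x hx
    have hε₆ := Ioo_neg_subset_Ioo_neg hle₇ hε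
    have hwx : 𝒢.src (θ ε x) ∈ tsupport χM →
        w ε (𝒢.src (θ ε x)) = χM (𝒢.src (θ ε x)) • f (θ ε x) := by
      intro hK
      have hxO : x ∈ O := by
        by_contra h
        exact havoid ε (Ioo_neg_subset_Ioo_neg hle₄ hε₆) x h hK
      have hχx : a x ∈ {z | χ z = 1} := interior_subset hxO.2
      simp only [hw]
      rw [hlφ ε (Ioo_neg_subset_Ioo_neg hle₂ hε₆) x hxO.1 hχx,
        a.left_inv hxO.1]
    -- Over `S` the cutoff equals `1` and `σ` reproduces `θ`. At a unit the fibre coordinate is `0`,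
    -- so scaling by `χM` changes nothing.
    rcases hx with hxS | hxu
    · obtain ⟨h1, h2⟩ := hSε ε (Ioo_neg_subset_Ioo_neg hle₅ hε₆) x hxS
      have hχK : 𝒢.src (θ ε x) ∈ {y | χM y = 1} := interior_subset h1
      have hχ1 : χM (𝒢.src (θ ε x)) = 1 := hχK
      rw [hσin ε _ (hχMone hχK), hwx (hχMone hχK), hχ1, one_smul, hψf _ h2]
    · by_cases hK : 𝒢.src (θ ε x) ∈ tsupport χM
      · have hfz : f (θ ε x) = 0 := by rw [hxu, hf1]
        rw [hσin ε _ hK, hwx hK, hfz, smul_zero, hψ1 _ (hχM hK).1.2, ← hxu]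
      · rw [hσout ε _ hK, ← hxu]

/-- Gauge families along an injective immersion of a compact manifold extend to families of
bisections. -/
theorem hasBisectionExtension_univ (hφ₀ : Continuous φ₀) (hinj : Function.Injective φ₀)
    (himm : Manifold.IsImmersion 𝓘(ℝ, EN) 𝓘(ℝ, EM) ∞ φ₀) :
    𝒢.HasBisectionExtension φ₀ EN univ := by
  refine isCompact_univ.induction_on HasBisectionExtension.empty
    (fun _ _ h => HasBisectionExtension.mono h) (fun _ _ => HasBisectionExtension.union) ?_
  intro x _
  rw [nhdsWithin_univ]
  exact exists_mem_nhds_hasBisectionExtension hφ₀ hinj (himm.isImmersionAt x)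

end LieGroupoid

/-! ### The two implications between the equivalence relations. -/

namespace LieGroupoid.Deformation

variable {EH EN EG EM : Type*}
  [NormedAddCommGroup EH] [NormedSpace ℝ EH]
  [NormedAddCommGroup EN] [NormedSpace ℝ EN]
  [NormedAddCommGroup EG] [NormedSpace ℝ EG]
  [NormedAddCommGroup EM] [NormedSpace ℝ EM]
  {H N G M : Type*}
  [TopologicalSpace H] [ChartedSpace EH H]
  [TopologicalSpace N] [ChartedSpace EN N]
  [TopologicalSpace G] [ChartedSpace EG G]
  [TopologicalSpace M] [ChartedSpace EM M]
  {ℋ : LieGroupoid EH EN H N} {𝒢 : LieGroupoid EG EM G M} {Φ₀ : H → G} {φ₀ : N → M}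
  {D D' : Deformation ℋ 𝒢 Φ₀ φ₀}

theorem Equivalent.stronglyEquivalent (hext : 𝒢.HasBisectionExtension φ₀ EN univ)
    (h : D.Equivalent D') : D.StronglyEquivalent D' := by
  obtain ⟨J, hJ, hJD, hJD', τ, hτ, hsτ, hτ0, hconj⟩ := h
  obtain ⟨δ, hδ, hδJ⟩ := hJ.exists_Ioo_subset
  -- The inverse of `τ` is extended because its source is `D'.base`, the base map along which strong
  -- equivalence evaluates `σ`.
  obtain ⟨δ', hδ', hle, σ, hσ, hστ⟩ := hext δ hδ (fun ε x => 𝒢.inv (τ ε x))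
    ⟨𝒢.contMDiff_inv.comp_contMDiffOn (hτ.mono (prod_mono_right hδJ)),
      fun x => by rw [hτ0, 𝒢.inv_one]⟩
  have hJ' : Ioo (-δ') δ' ⊆ J := (Ioo_neg_subset_Ioo_neg hle).trans hδJ
  refine ⟨Ioo (-δ') δ', isOpenIntervalZero_Ioo hδ', hJ'.trans hJD, hJ'.trans hJD', σ,
    hσ.contMDiffOn, hσ.isBisection, hσ.zero, fun ε hε h => ?_⟩
  have hD := D.isMorphism ε (hJD (hJ' hε))
  have hD' := D'.isMorphism ε (hJD' (hJ' hε))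
  have h1 : ∀ h, 𝒢.src (τ ε (ℋ.tgt h)) = 𝒢.tgt (D.map ε h) := fun h => by
    rw [hsτ ε (hJ' hε), hD.tgt_map]
  have h2 : ∀ h, 𝒢.src (D.map ε h) = 𝒢.src (τ ε (ℋ.src h)) := fun h => by
    rw [hsτ ε (hJ' hε), hD.src_map]
  have htτ : ∀ x, 𝒢.tgt (τ ε x) = D'.base ε x := fun x => by
    -- The target of `τ ε x` is not prescribed by gauge equivalence; it is read off from the
    -- conjugation formula at the unit of `x`.
    have h3 := hD'.tgt_map (ℋ.one x)
    rw [hconj ε (hJ' hε), 𝒢.tgt_conj (h1 _) (h2 _), ℋ.tgt_one] at h3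
    exact h3
  have hσx : ∀ x, σ ε (D'.base ε x) = 𝒢.inv (τ ε x) := fun x => by
    have h3 := hστ ε hε x (Or.inl (mem_univ x))
    rwa [𝒢.src_inv, htτ] at h3
  rw [hσx, hσx, hconj ε (hJ' hε), 𝒢.conj_inv_conj (h1 h) (h2 h)]

/-- Restricting the bisections along `D'.base` and inverting gives the gauge maps; their source is
found by comparing targets in the conjugation formula at units. -/
theorem StronglyEquivalent.equivalent (h : D.StronglyEquivalent D') : D.Equivalent D' := by
  obtain ⟨J, hJ, hJD, hJD', σ, hσ, hbis, hσ0, hconj⟩ := h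
  have h1 : ∀ ε ∈ J, ∀ h, 𝒢.src (σ ε (D'.base ε (ℋ.tgt h))) = 𝒢.tgt (D'.map ε h) :=
    fun ε hε h => by rw [(hbis ε hε).src_apply, (D'.isMorphism ε (hJD' hε)).tgt_map]
  have h2 : ∀ ε ∈ J, ∀ h, 𝒢.src (D'.map ε h) = 𝒢.src (σ ε (D'.base ε (ℋ.src h))) :=
    fun ε hε h => by rw [(hbis ε hε).src_apply, (D'.isMorphism ε (hJD' hε)).src_map]
  refine ⟨J, hJ, hJD, hJD', fun ε x => 𝒢.inv (σ ε (D'.base ε x)), ?_, fun ε hε x => ?_,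
    fun x => ?_, fun ε hε h => ?_⟩
  · refine 𝒢.contMDiff_inv.comp_contMDiffOn ?_
    exact hσ.comp (f := fun p : N × ℝ => (D'.base p.2 p.1, p.2))
      ((D'.contMDiffOn_base.mono (prod_mono_right hJD')).prodMk contMDiffOn_snd)
      fun p hp => ⟨mem_univ _, hp.2⟩
  · have h3 := (D.isMorphism ε (hJD hε)).tgt_map (ℋ.one x)
    rw [hconj ε hε, 𝒢.tgt_conj (h1 ε hε _) (h2 ε hε _), ℋ.tgt_one] at h3
    rw [𝒢.src_inv, h3]
  · beta_reduce
    rw [hσ0, D'.base_zero, 𝒢.inv_one]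
  · rw [hconj ε hε, 𝒢.conj_inv_conj (h1 ε hε h) (h2 ε hε h)]

end LieGroupoid.Deformation

end SmoothFamilies

theorem mainTheorem11 {EH EN EG EM : Type*}
    [NormedAddCommGroup EH] [NormedSpace ℝ EH] [FiniteDimensional ℝ EH]
    [NormedAddCommGroup EN] [NormedSpace ℝ EN] [FiniteDimensional ℝ EN]
    [NormedAddCommGroup EG] [NormedSpace ℝ EG] [FiniteDimensional ℝ EG]
    [NormedAddCommGroup EM] [NormedSpace ℝ EM] [FiniteDimensional ℝ EM]
    {H N G M : Type*}
    [TopologicalSpace H] [ChartedSpace EH H] [IsManifold 𝓘(ℝ, EH) ∞ H]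
    [TopologicalSpace N] [ChartedSpace EN N] [IsManifold 𝓘(ℝ, EN) ∞ N]
    [T2Space N] [SecondCountableTopology N] [CompactSpace N]
    [TopologicalSpace G] [ChartedSpace EG G] [IsManifold 𝓘(ℝ, EG) ∞ G] [T2Space G]
    [TopologicalSpace M] [ChartedSpace EM M] [IsManifold 𝓘(ℝ, EM) ∞ M]
    [T2Space M] [SecondCountableTopology M]
    (ℋ : LieGroupoid EH EN H N) (𝒢 : LieGroupoid EG EM G M)
    (Φ₀ : H → G) (φ₀ : N → M) (hΦ₀ : LieGroupoid.IsMorphism ℋ 𝒢 Φ₀ φ₀)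
    (hinj : Function.Injective φ₀)
    (himm : Manifold.IsImmersion 𝓘(ℝ, EN) 𝓘(ℝ, EM) ∞ φ₀)
    (D D' : LieGroupoid.Deformation ℋ 𝒢 Φ₀ φ₀) :
    D.Equivalent D' ↔ D.StronglyEquivalent D' :=
  ⟨LieGroupoid.Deformation.Equivalent.stronglyEquivalent
    (LieGroupoid.hasBisectionExtension_univ hΦ₀.contMDiff_base.continuous hinj himm),
    LieGroupoid.Deformation.StronglyEquivalent.equivalent⟩
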